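/- Let $q,x,y,z\in\mathbb{C}$ with $q\neq 0$, $|q|<|y|<1$, $|q|<|z|<1$, and let $x$ be neither zero nor an integral power of $q$. Write $(a;q)_\infty=\prod_{i\ge 0}(1-q^i a)$ and $(a_1,\dots,a_n;q)_\infty=(a_1;q)_\infty\cdots(a_n;q)_\infty$. Then \begin{align*} \Big(\sum_{s,t\ge 0}-\sum_{s,t<0}\Big)\frac{q^{st}y^sz^t}{1-xq^{s+t}} ={}&\frac{(yz,q^2/yz;q^2)_\infty}{(y,z,q/y,q/z;q)_\infty}\frac{(q;q)_\infty^2}{(q^2;q^2)_\infty}\sum_{k\in\mathbb{Z}}\frac{(-1)^kq^{k^2}(yz)^k}{1+q^{2k}x}\\ &+\frac{(xy,q^2/xy;q^2)_\infty}{(x,y,q/x,q/y;q)_\infty}\frac{(q;q)_\infty^2}{(q^2;q^2)_\infty}\sum_{k\in\mathbb{Z}}\frac{(-1)^kq^{k^2}(xy)^k}{1+q^{2k}z}\\ &-2\,\frac{(q^2;q^2)_\infty^3}{(x,y,z,q/x,q/y,q/z;q)_\infty}\,\frac{(xy,xz,yz,q^2/xy,q^2/xz,q^2/yz;q^2)_\infty}{(-x,-y,-z,-q^2/x,-q^2/y,-q^2/z;q^2)_\infty}\\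 &+\frac{(xz,q^2/xz;q^2)_\infty}{(x,z,q/x,q/z;q)_\infty}\frac{(q;q)_\infty^2}{(q^2;q^2)_\infty}\sum_{k\in\mathbb{Z}}\frac{(-1)^kq^{k^2}(xz)^k}{1+q^{2k}y}, \end{align*} where all the series converge absolutely. If $x=-q^{2k}$ for some $k\in\mathbb{Z}$, the first and third terms on the right are undefined; there the right-hand side has a removable singularity as a function of $x$, and is understood as its limit. -/

import Mathlib

open Filter Topology

noncomputable section

namespace Kronecker

/-- The infinite `q`-Pochhammer symbol `(a; q)_∞ = ∏_{i ≥ 0} (1 - q ^ i a)`. -/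
def qPoch (a q : ℂ) : ℂ := ∏' i : ℕ, (1 - q ^ i * a)

/-- The product defining `(a; q)_∞` converges whenever `|q| < 1`. -/
theorem multipliable_qPoch (a : ℂ) {q : ℂ} (hq : ‖q‖ < 1) :
    Multipliable fun i : ℕ => 1 - q ^ i * a := by
  have h : Summable fun i : ℕ => ‖-(q ^ i * a)‖ := by
    simpa [norm_mul, norm_pow] using
      (summable_geometric_of_lt_one (norm_nonneg q) hq).mul_right ‖a‖
  simpa [sub_eq_add_neg] using multipliable_one_add_of_summable h

/-- The multi-argument symbol `(a₁, …, aₙ; q)_∞ = (a₁; q)_∞ ⋯ (aₙ; q)_∞`. -/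
def qPochs (as : List ℂ) (q : ℂ) : ℂ := (as.map fun a => qPoch a q).prod

/-- The summand `q ^ (s t) y ^ s z ^ t / (1 - x q ^ (s + t))` for integers `s`, `t`. -/
def term (q x y z : ℂ) (s t : ℤ) : ℂ :=
  q ^ (s * t) * y ^ s * z ^ t / (1 - x * q ^ (s + t))

/-- The summands with `s, t ≥ 0`. -/
def termNonneg (q x y z : ℂ) (p : ℕ × ℕ) : ℂ := term q x y z (p.1 : ℤ) (p.2 : ℤ)

/-- The summands with `s, t < 0`, where `s = -(m + 1)` and `t = -(n + 1)` with `m, n ≥ 0`. -/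
def termNeg (q x y z : ℂ) (p : ℕ × ℕ) : ℂ :=
  term q x y z (-((p.1 : ℤ) + 1)) (-((p.2 : ℤ) + 1))

/-- `(∑_{s,t ≥ 0} - ∑_{s,t < 0}) q ^ (s t) y ^ s z ^ t / (1 - x q ^ (s + t))`. -/
def doubleSum (q x y z : ℂ) : ℂ :=
  (∑' p : ℕ × ℕ, termNonneg q x y z p) - (∑' p : ℕ × ℕ, termNeg q x y z p)

/-- The summand `(-1) ^ k q ^ (k²) u ^ k / (1 + q ^ (2 k) v)` of the Lerch-type sum. -/
def lerchTerm (q u v : ℂ) (k : ℤ) : ℂ :=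
  (-1) ^ k * q ^ (k ^ 2) * u ^ k / (1 + q ^ (2 * k) * v)

/-- The term
`(ab, q²/ab; q²)_∞ / (a, b, q/a, q/b; q)_∞ * (q; q)_∞² / (q²; q²)_∞
  * ∑_{k ∈ ℤ} (-1) ^ k q ^ (k²) (ab) ^ k / (1 + q ^ (2 k) c)`. -/
def lerchPart (q a b c : ℂ) : ℂ :=
  qPochs [a * b, q ^ 2 / (a * b)] (q ^ 2) / qPochs [a, b, q / a, q / b] q
    * (qPoch q q ^ 2 / qPoch (q ^ 2) (q ^ 2)) * ∑' k : ℤ, lerchTerm q (a * b) c k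

/-- The quotient of theta products in `q` and `q²` (without the factor `-2`). -/
def thetaPart (q x y z : ℂ) : ℂ :=
  qPoch (q ^ 2) (q ^ 2) ^ 3 / qPochs [x, y, z, q / x, q / y, q / z] q
    * (qPochs [x * y, x * z, y * z, q ^ 2 / (x * y), q ^ 2 / (x * z), q ^ 2 / (y * z)] (q ^ 2)
      / qPochs [-x, -y, -z, -q ^ 2 / x, -q ^ 2 / y, -q ^ 2 / z] (q ^ 2))

/-- The closed form of the double sum. -/
def closedForm (q x y z : ℂ) : ℂ :=
  lerchPart q y z x + lerchPart q x y z - 2 * thetaPart q x y z + lerchPart q x z y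

end Kronecker

end

/-! Fix `q`, `y`, `z` and regard both sides as functions of `x` on the punctured plane. Their
difference `g` satisfies `g (q² x) = (q / (y z)) x g x` and has only removable singularities, which
forces it to vanish. Indeed `x * g x` extends holomorphically to `0`; if it vanished there to exact
order `n`, comparing leading coefficients would make `q ^ (2 n)` equal to `q²` times the value of
the multiplier at `0`, namely `0`. So `g` is zero near `0`, and the equation carries this outward
(`eq_zero_of_quasiperiodic`).

The functional equation: shifting `(s, t)` to `(s + 1, t + 1)` reproduces the double sum up to the
terms on the two axes and a numerator sum, all of which are Kronecker series (`doubleSum_mul_sq`).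
On the other side the Lerch-type sums reproduce themselves up to theta series. Kronecker's formula
(`kronSum_eq`) and Jacobi's triple product (`thetaSum_eq`) make these inhomogeneous terms agree
(`lerchCoeff_mul_thetaSum`).

The singularities: the candidates are the powers of `q` and the points `-q ^ (2 k)`, so modulo
multiplication by `q²` only `1`, `q` and `-1` need checking. At `-1` the Lerch-type sum in `x`
balances the theta quotient, through `theta_neg_one_mul`. At `1` and `q` the polar parts cancel by
two reflection identities between the Lerch-type sums with `y` and `z` exchanged
(`lerchSum_div_add_lerchSum_div`, `lerchSum_const_mul_add`). Both specialise the change-of-base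
formula `lerchSum_div_sub`, which, like Kronecker's formula, is itself proved by the same vanishing
principle. -/

noncomputable section

namespace Kronecker

/-! ### Calculus of simple poles. -/

/-- `g` has at `a` at most a simple pole with polar part `r / (1 - x / a)`; the value `g a` is
irrelevant. -/
def PoleAt (g : ℂ → ℂ) (a r : ℂ) : Prop :=
  ∃ E : ℂ → ℂ, AnalyticAt ℂ E a ∧ g =ᶠ[𝓝[≠] a] fun x => r / (1 - x / a) + E x

theorem poleAt_of_analyticAt {g : ℂ → ℂ} {a : ℂ} (hg : AnalyticAt ℂ g a) : PoleAt g a 0 :=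
  ⟨g, hg, by simp⟩

theorem poleAt_one_div (a : ℂ) : PoleAt (fun x => 1 / (1 - x / a)) a 1 :=
  ⟨fun _ => 0, analyticAt_const, by simp⟩

theorem PoleAt.congr {g g' : ℂ → ℂ} {a r : ℂ} (hg : PoleAt g a r) (h : g' =ᶠ[𝓝[≠] a] g) :
    PoleAt g' a r := by
  obtain ⟨E, hE, he⟩ := hg
  exact ⟨E, hE, h.trans he⟩

theorem PoleAt.congr_residue {g : ℂ → ℂ} {a r r' : ℂ} (hg : PoleAt g a r) (h : r = r') :
    PoleAt g a r' := h ▸ hg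

theorem PoleAt.congr_point {g : ℂ → ℂ} {a b r : ℂ} (hg : PoleAt g a r) (h : a = b) :
    PoleAt g b r := h ▸ hg

theorem PoleAt.add {g h : ℂ → ℂ} {a r s : ℂ} (hg : PoleAt g a r) (hh : PoleAt h a s) :
    PoleAt (fun x => g x + h x) a (r + s) := by
  obtain ⟨E, hE, he⟩ := hg
  obtain ⟨F, hF, hf⟩ := hh
  refine ⟨fun x => E x + F x, hE.add hF, ?_⟩
  filter_upwards [he, hf] with x h1 h2
  rw [h1, h2]; ring

/-- Write `u x = u a + (x - a) * dslope u a x`. Since `x - a = -a (1 - x / a)`, the second summand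
cancels the pole and contributes only an analytic term. -/
theorem PoleAt.analytic_mul {g u : ℂ → ℂ} {a r : ℂ} (ha : a ≠ 0) (hu : AnalyticAt ℂ u a)
    (hg : PoleAt g a r) : PoleAt (fun x => u x * g x) a (u a * r) := by
  obtain ⟨E, hE, he⟩ := hg
  obtain ⟨s, hs⟩ := id hu
  have hd : AnalyticAt ℂ (dslope u a) a := hs.has_fpower_series_dslope_fslope.analyticAt
  refine ⟨fun x => -(a * r) * dslope u a x + u x * E x,
    (analyticAt_const.mul hd).add (hu.mul hE), ?_⟩
  filter_upwards [he, self_mem_nhdsWithin] with x h1 hx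
  have hx' : x - a ≠ 0 := sub_ne_zero.2 hx
  have h2 : u x = u a + (x - a) * dslope u a x := by
    have := sub_smul_dslope u a x
    rw [smul_eq_mul] at this
    rw [this]; ring
  have h3 : 1 - x / a ≠ 0 := by
    rw [one_sub_div ha]
    exact div_ne_zero (by rwa [← neg_sub, neg_ne_zero]) ha
  have h4 : x - a = -a * (1 - x / a) := by field_simp; ring
  rw [h1]
  have h5 : u x * (r / (1 - x / a)) = u a * r / (1 - x / a) - a * r * dslope u a x := by
    rw [h2, h4]
    generalize 1 - x / a = w at h3
    field_simp
    ring
  rw [mul_add, h5]; ring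

theorem PoleAt.const_mul {g : ℂ → ℂ} {a r : ℂ} (ha : a ≠ 0) (c : ℂ) (hg : PoleAt g a r) :
    PoleAt (fun x => c * g x) a (c * r) :=
  PoleAt.analytic_mul (u := fun _ => c) ha analyticAt_const hg

theorem PoleAt.sub {g h : ℂ → ℂ} {a r s : ℂ} (ha : a ≠ 0) (hg : PoleAt g a r)
    (hh : PoleAt h a s) : PoleAt (fun x => g x - h x) a (r - s) := by
  refine ((hg.add (hh.const_mul ha (-1))).congr ?_).congr_residue (by ring)
  exact Eventually.of_forall fun x => by ring

theorem tendsto_const_mul_punctured {a b : ℂ} (hb : b ≠ 0) :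
    Tendsto (fun x => b * x) (𝓝[≠] a) (𝓝[≠] (b * a)) := by
  refine tendsto_nhdsWithin_of_tendsto_nhds_of_eventually_within _ ?_ ?_
  · exact ((continuous_const_mul b).tendsto a).mono_left nhdsWithin_le_nhds
  · filter_upwards [self_mem_nhdsWithin] with x hx
    simpa [hb] using hx

/-- The polar part is normalised by `1 - x / a` rather than `x - a` so that rescaling the variable
leaves the coefficient unchanged. -/
theorem PoleAt.comp_const_mul {g : ℂ → ℂ} {a b r : ℂ} (hb : b ≠ 0) (hg : PoleAt g (b * a) r) :
    PoleAt (fun x => g (b * x)) a r := by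
  obtain ⟨E, hE, he⟩ := hg
  refine ⟨fun x => E (b * x), ?_, ?_⟩
  · exact AnalyticAt.comp (f := fun x => b * x) hE (by fun_prop)
  · filter_upwards [(tendsto_const_mul_punctured hb).eventually he] with x hx
    rw [hx, mul_div_mul_left _ _ hb]

theorem PoleAt.tendsto_limUnder {g : ℂ → ℂ} {a : ℂ} (hg : PoleAt g a 0) :
    Tendsto g (𝓝[≠] a) (𝓝 (limUnder (𝓝[≠] a) g)) := by
  obtain ⟨E, hE, he⟩ := hg
  refine tendsto_nhds_limUnder ⟨E a, ?_⟩
  refine Tendsto.congr' ?_ (hE.continuousAt.tendsto.mono_left nhdsWithin_le_nhds)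
  filter_upwards [he] with x hx
  simp [hx]

/-- Replacing `g` by its punctured limits discards the arbitrary values at singular points. At every
point near `a`, not only at `a`, this limit is the value of the analytic representative. -/
theorem PoleAt.analyticAt_limUnder {g : ℂ → ℂ} {a : ℂ} (hg : PoleAt g a 0) :
    AnalyticAt ℂ (fun x => limUnder (𝓝[≠] x) g) a := by
  obtain ⟨E, hE, he⟩ := hg
  have key : ∀ b : ℂ, ContinuousAt E b → g =ᶠ[𝓝[≠] b] E → limUnder (𝓝[≠] b) g = E b := by
    intro b hb hgb
    exact ((hb.tendsto.mono_left nhdsWithin_le_nhds).congr' hgb.symm).limUnder_eq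
  have he' : g =ᶠ[𝓝[≠] a] E := by
    filter_upwards [he] with x hx
    simp [hx]
  refine hE.congr ?_
  have h1 : ∀ᶠ x in 𝓝 a, x ≠ a → g x = E x := eventually_nhdsWithin_iff.1 he'
  filter_upwards [h1.eventually_nhds, hE.eventually_analyticAt] with x hx hEx
  symm
  refine key x hEx.continuousAt ?_
  by_cases hxa : x = a
  · rw [hxa]; exact he'
  · have : ∀ᶠ w in 𝓝 x, w ≠ a := isOpen_ne.mem_nhds hxa
    filter_upwards [hx.filter_mono nhdsWithin_le_nhds, this.filter_mono nhdsWithin_le_nhds]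
      with w h1 h2 using h1 h2

/-! ### Vanishing of quasiperiodic functions on the punctured plane. -/

/-- A holomorphic function on the punctured plane with `h (p x) = φ x * h x`, where `φ` is
continuous and `φ 0` is small but not a power of `p`, vanishes identically. -/
theorem eq_zero_of_analytic_quasiperiodic {p : ℂ} (hp0 : p ≠ 0) (hp1 : ‖p‖ < 1) {h φ : ℂ → ℂ}
    (hh : ∀ a, a ≠ 0 → AnalyticAt ℂ h a) (hφ : Continuous φ) (hφ0 : ∀ x, x ≠ 0 → φ x ≠ 0)
    (hs : ‖p * φ 0‖ < 1) (hpow : ∀ n : ℕ, φ 0 ≠ p ^ n)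
    (hfe : ∀ x, x ≠ 0 → h (p * x) = φ x * h x) : ∀ x, x ≠ 0 → h x = 0 := by
  have hpn : 0 < ‖p‖ := norm_pos_iff.2 hp0
  -- The factor `x` changes the multiplier to `p * φ`, of modulus less than `1` at `0`, so that `H`
  -- does not grow towards `0`.
  set H : ℂ → ℂ := fun x => x * h x with hH
  have hHfe : ∀ x, x ≠ 0 → H (p * x) = p * φ x * H x := by
    intro x hx
    simp only [hH, hfe x hx]; ring
  obtain ⟨r, hr, hrφ⟩ : ∃ r > 0, ∀ x : ℂ, ‖x‖ ≤ r → ‖p * φ x‖ ≤ 1 := by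
    have : ∀ᶠ x in 𝓝 (0 : ℂ), ‖p * φ x‖ < 1 :=
      (continuous_const.mul hφ).norm.continuousAt.eventually_lt continuousAt_const hs
    obtain ⟨ε, hε, hb⟩ := Metric.eventually_nhds_iff.1 this
    refine ⟨ε / 2, by positivity, fun x hx => (hb ?_).le⟩
    rw [dist_zero_right]; linarith
  -- This closed annulus meets every orbit of multiplication by `p`; a bound on it spreads to the
  -- whole punctured disc.
  have hcomp : IsCompact (Metric.closedBall (0 : ℂ) r \ Metric.ball 0 (‖p‖ * r)) :=
    (isCompact_closedBall _ _).diff Metric.isOpen_ball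
  have hne : ∀ x : ℂ, ‖p‖ * r ≤ ‖x‖ → x ≠ 0 := by
    rintro x hx rfl
    have : 0 < ‖p‖ * r := by positivity
    simp at hx; linarith
  obtain ⟨M, hM⟩ := hcomp.exists_bound_of_continuousOn (f := H) (by
    intro x hx
    have hx0 : x ≠ 0 := hne x (by simpa using hx.2)
    exact (continuousAt_id.mul (hh x hx0).continuousAt).continuousWithinAt)
  have hiter : ∀ n : ℕ, ∀ x : ℂ, x ≠ 0 → ‖x‖ ≤ r → ‖H (p ^ n * x)‖ ≤ ‖H x‖ := by
    intro n
    induction n with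
    | zero => intro x _ _; simp
    | succ n ih =>
      intro x hx hxr
      have h1 : p ^ n * x ≠ 0 := mul_ne_zero (pow_ne_zero _ hp0) hx
      have h2 : ‖p ^ n * x‖ ≤ r := by
        rw [norm_mul, norm_pow]
        calc ‖p‖ ^ n * ‖x‖ ≤ 1 * ‖x‖ := by
              gcongr; exact pow_le_one₀ hpn.le hp1.le
          _ ≤ r := by simpa using hxr
      have h3 : p ^ (n + 1) * x = p * (p ^ n * x) := by ring
      rw [h3, hHfe _ h1, norm_mul]
      calc ‖p * φ (p ^ n * x)‖ * ‖H (p ^ n * x)‖ ≤ 1 * ‖H (p ^ n * x)‖ := by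
            gcongr; exact hrφ _ h2
        _ ≤ ‖H x‖ := by simpa using ih x hx hxr
  have hbound : ∀ x : ℂ, x ≠ 0 → ‖x‖ ≤ r → ‖H x‖ ≤ M := by
    intro x hx hxr
    obtain ⟨n, hn1, hn2⟩ := exists_nat_pow_near_of_lt_one (x := ‖x‖ / r) (y := ‖p‖)
      (div_pos (norm_pos_iff.2 hx) hr) ((div_le_one hr).2 hxr) hpn hp1
    have hpn' : p ^ n ≠ 0 := pow_ne_zero _ hp0
    have hx1 : p ^ n * (x / p ^ n) = x := mul_div_cancel₀ _ hpn'
    have hpp : 0 < ‖p‖ ^ n := by positivity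
    have hx2 : ‖x / p ^ n‖ ≤ r := by
      rw [norm_div, norm_pow, div_le_iff₀ hpp]
      rw [div_le_iff₀ hr] at hn2
      linarith
    have hx3 : ‖p‖ * r ≤ ‖x / p ^ n‖ := by
      rw [norm_div, norm_pow, le_div_iff₀ hpp]
      rw [lt_div_iff₀ hr] at hn1
      calc ‖p‖ * r * ‖p‖ ^ n = ‖p‖ ^ (n + 1) * r := by ring
        _ ≤ ‖x‖ := hn1.le
    rw [← hx1]
    refine (hiter n _ (div_ne_zero hx hpn') hx2).trans (hM _ ⟨?_, ?_⟩)
    · simpa using hx2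
    · simpa using hx3
  set H' : ℂ → ℂ := Function.update H 0 (limUnder (𝓝[≠] 0) H) with hH'
  have hH'an : AnalyticAt ℂ H' 0 := by
    have hd := Complex.differentiableOn_update_limUnder_of_bddAbove (f := H)
      (s := Metric.ball 0 r) (c := 0) (Metric.ball_mem_nhds _ hr)
      (fun x hx => ((differentiableAt_id.mul
        (hh x (by simpa using hx.2)).differentiableAt).differentiableWithinAt))
      ⟨M, by
        rintro _ ⟨x, hx, rfl⟩
        exact hbound x (by simpa using hx.2) (by simpa using (Metric.mem_ball.1 hx.1).le)⟩
    exact hd.analyticAt (Metric.ball_mem_nhds _ hr)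
  have hH'eq : ∀ x, x ≠ 0 → H' x = H x := fun x hx => by simp [hH', hx]
  have hzero : ∀ᶠ x in 𝓝 (0 : ℂ), H' x = 0 := by
    by_contra hcon
    -- Let `n` be the exact order of vanishing at `0`. The functional equation gives `p ^ n = p * φ
    -- 0`, which `hs` excludes for `n = 0` and `hpow` for `n > 0`.
    obtain ⟨n, u, hu, hu0, hn⟩ := hH'an.exists_eventuallyEq_pow_smul_nonzero_iff.2 hcon
    have hmul : Tendsto (fun x : ℂ => p * x) (𝓝 0) (𝓝 0) := by
      simpa using (continuous_const_mul p).tendsto (0 : ℂ)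
    have heq : ∀ᶠ x in 𝓝[≠] (0 : ℂ), p ^ n * u (p * x) = p * φ x * u x := by
      filter_upwards [hn.filter_mono nhdsWithin_le_nhds,
        (hmul.eventually hn).filter_mono nhdsWithin_le_nhds, self_mem_nhdsWithin] with x h1 h2 hx
      have hx : x ≠ 0 := hx
      rw [hH'eq _ hx] at h1
      rw [hH'eq _ (mul_ne_zero hp0 hx), hHfe _ hx, h1] at h2
      simp only [sub_zero, smul_eq_mul, mul_pow] at h2
      have hxn : x ^ n ≠ 0 := pow_ne_zero _ hx
      apply mul_left_cancel₀ hxn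
      linear_combination -h2
    have hl1 : Tendsto (fun x => p ^ n * u (p * x)) (𝓝[≠] 0) (𝓝 (p ^ n * u 0)) :=
      ((hu.continuousAt.tendsto.comp hmul).const_mul _).mono_left nhdsWithin_le_nhds
    have hl2 : Tendsto (fun x => p * φ x * u x) (𝓝[≠] 0) (𝓝 (p * φ 0 * u 0)) :=
      (((hφ.tendsto 0).const_mul p).mul hu.continuousAt.tendsto).mono_left nhdsWithin_le_nhds
    have hfin := mul_right_cancel₀ hu0 (tendsto_nhds_unique (hl1.congr' heq) hl2)
    cases n with
    | zero => rw [← hfin] at hs; simp at hs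
    | succ n =>
      rw [pow_succ'] at hfin
      exact hpow n (mul_left_cancel₀ hp0 hfin).symm
  obtain ⟨ε, hε, hz⟩ := Metric.eventually_nhds_iff.1 hzero
  intro x hx
  -- Every orbit enters the disc where `h` is zero, and `φ` has no zeros, so the vanishing
  -- propagates back.
  have hback : ∀ n : ℕ, h (p ^ n * x) = 0 → h x = 0 := by
    intro n
    induction n with
    | zero => simp
    | succ n ih =>
      intro hn
      have h1 : p ^ n * x ≠ 0 := mul_ne_zero (pow_ne_zero _ hp0) hx
      rw [pow_succ', mul_assoc, hfe _ h1] at hn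
      exact ih ((mul_eq_zero.1 hn).resolve_left (hφ0 _ h1))
  have hlim : Tendsto (fun n : ℕ => p ^ n * x) atTop (𝓝 0) := by
    simpa using (tendsto_pow_atTop_nhds_zero_of_norm_lt_one hp1).mul_const x
  obtain ⟨n, hn⟩ := ((Metric.tendsto_nhds.1 hlim ε hε)).exists
  have h1 : p ^ n * x ≠ 0 := mul_ne_zero (pow_ne_zero _ hp0) hx
  refine hback n ?_
  have := hz hn
  rw [hH'eq _ h1] at this
  exact (mul_eq_zero.1 this).resolve_left h1

/-- Transport of a removable singularity along `g (p x) = φ x * g x`. -/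
theorem PoleAt.zpow_mul {p : ℂ} (hp0 : p ≠ 0) {g φ : ℂ → ℂ} (hφ : ∀ a, AnalyticAt ℂ φ a)
    (hφ0 : ∀ x, x ≠ 0 → φ x ≠ 0)
    (hfe : ∀ a, a ≠ 0 → ∀ᶠ x in 𝓝[≠] a, g (p * x) = φ x * g x) {a : ℂ} (ha : a ≠ 0)
    (hg : PoleAt g a 0) (n : ℤ) : PoleAt g (p ^ n * a) 0 := by
  induction n using Int.induction_on with
  | zero => simpa using hg
  | succ n ih =>
    have hb : p ^ (n : ℤ) * a ≠ 0 := mul_ne_zero (zpow_ne_zero _ hp0) ha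
    have h1 : PoleAt (fun x => g (p * x)) (p ^ (n : ℤ) * a) 0 :=
      ((ih.analytic_mul hb (hφ _)).congr (hfe _ hb)).congr_residue (by simp)
    have h2 : p⁻¹ * (p ^ ((n : ℤ) + 1) * a) = p ^ (n : ℤ) * a := by
      rw [zpow_add_one₀ hp0]; field_simp
    rw [← h2] at h1
    refine (h1.comp_const_mul (inv_ne_zero hp0)).congr (Eventually.of_forall fun x => ?_)
    simp [mul_inv_cancel_left₀ hp0]
  | pred n ih =>
    have hb : p ^ (-(n : ℤ) - 1) * a ≠ 0 := mul_ne_zero (zpow_ne_zero _ hp0) ha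
    have h2 : p * (p ^ (-(n : ℤ) - 1) * a) = p ^ (-(n : ℤ)) * a := by
      rw [zpow_sub_one₀ hp0]; field_simp
    rw [← h2] at ih
    have h1 := (ih.comp_const_mul hp0).analytic_mul hb ((hφ _).inv (hφ0 _ hb))
    refine (h1.congr ?_).congr_residue (by simp)
    have hne : ∀ᶠ x in 𝓝[≠] (p ^ (-(n : ℤ) - 1) * a), x ≠ 0 :=
      (isOpen_ne.eventually_mem hb).filter_mono nhdsWithin_le_nhds
    filter_upwards [hfe _ hb, hne] with x hx hx0
    rw [hx, Pi.inv_apply, inv_mul_cancel_left₀ (hφ0 _ hx0)]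

/-- A function on the punctured plane with removable singularities and `g (p x) = φ x * g x`,
where `φ 0` is small but not a power of `p`, vanishes off its singularities. -/
theorem eq_zero_of_quasiperiodic {p : ℂ} (hp0 : p ≠ 0) (hp1 : ‖p‖ < 1) {g φ : ℂ → ℂ}
    (hg : ∀ a, a ≠ 0 → PoleAt g a 0) (hφ : Continuous φ) (hφ0 : ∀ x, x ≠ 0 → φ x ≠ 0)
    (hs : ‖p * φ 0‖ < 1) (hpow : ∀ n : ℕ, φ 0 ≠ p ^ n)
    (hfe : ∀ a, a ≠ 0 → ∀ᶠ x in 𝓝[≠] a, g (p * x) = φ x * g x) {x : ℂ} (hx : x ≠ 0)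
    (hc : ContinuousAt g x) : g x = 0 := by
  have h := eq_zero_of_analytic_quasiperiodic hp0 hp1
    (h := fun x => limUnder (𝓝[≠] x) g) (φ := φ) (fun a ha => (hg a ha).analyticAt_limUnder)
    hφ hφ0 hs hpow (by
      intro a ha
      have h1 := (hg (p * a) (mul_ne_zero hp0 ha)).tendsto_limUnder.comp
        (tendsto_const_mul_punctured hp0)
      have h2 := (hφ.continuousAt.tendsto.mono_left nhdsWithin_le_nhds).mul
        (hg a ha).tendsto_limUnder
      exact tendsto_nhds_unique (h1.congr' (hfe a ha)) h2) x hx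
  exact (hc.tendsto.mono_left nhdsWithin_le_nhds).limUnder_eq.symm.trans h

/-! ### Infinite products: zeros, holomorphy, change of base. -/

section Pochhammer

theorem summable_norm_qPoch (a : ℂ) {q : ℂ} (hq : ‖q‖ < 1) :
    Summable fun i : ℕ => ‖-(q ^ i * a)‖ := by
  simpa [norm_mul, norm_pow] using
    (summable_geometric_of_lt_one (norm_nonneg q) hq).mul_right ‖a‖

theorem qPoch_eq_one_sub_mul (a : ℂ) {q : ℂ} (hq : ‖q‖ < 1) :
    qPoch a q = (1 - a) * qPoch (q * a) q := by
  have h : ∀ i : ℕ, 1 - q ^ (i + 1) * a = 1 - q ^ i * (q * a) := fun i => by ring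
  have hm : Multipliable fun i : ℕ => 1 - q ^ (i + 1) * a := by
    simpa only [h] using multipliable_qPoch (q * a) hq
  have h2 := tprod_eq_zero_mul' (f := fun i : ℕ => 1 - q ^ i * a) hm
  simp only [pow_zero, one_mul, h] at h2
  exact h2

theorem qPoch_ne_zero {a q : ℂ} (hq : ‖q‖ < 1) (h : ∀ i : ℕ, q ^ i * a ≠ 1) :
    qPoch a q ≠ 0 := by
  have := tprod_one_add_ne_zero_of_summable (f := fun i : ℕ => -(q ^ i * a))
    (fun i => by simpa [← sub_eq_add_neg, sub_eq_zero] using (h i).symm)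
    (summable_norm_qPoch a hq)
  simpa only [qPoch, sub_eq_add_neg] using this

theorem differentiable_qPoch {q : ℂ} (hq : ‖q‖ < 1) : Differentiable ℂ fun a => qPoch a q := by
  intro a
  have hu : Summable fun i : ℕ => ‖q‖ ^ i * (‖a‖ + 1) :=
    (summable_geometric_of_lt_one (norm_nonneg q) hq).mul_right _
  have h := Summable.hasProdLocallyUniformlyOn_nat_one_add
    (f := fun (i : ℕ) (x : ℂ) => -(q ^ i * x)) (Metric.isOpen_ball (x := a) (ε := 1)) hu
    (Eventually.of_forall fun n x hx => by
      rw [norm_neg, norm_mul, norm_pow]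
      gcongr
      have := norm_sub_norm_le x a
      rw [Metric.mem_ball, dist_eq_norm] at hx
      linarith) (fun n => by fun_prop)
  have hd := h.differentiableOn (.of_forall fun _ => by
    simpa [Finset.prod_fn] using DifferentiableOn.finsetProd (fun _ _ => by fun_prop))
    Metric.isOpen_ball
  have := hd.differentiableAt (Metric.ball_mem_nhds a one_pos)
  simpa only [qPoch, sub_eq_add_neg] using this

theorem analyticAt_qPoch {q : ℂ} (hq : ‖q‖ < 1) (a : ℂ) : AnalyticAt ℂ (fun a => qPoch a q) a :=
  (differentiable_qPoch hq).analyticAt a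

theorem norm_sq_lt_one {q : ℂ} (hq : ‖q‖ < 1) : ‖q ^ 2‖ < 1 := by
  rw [norm_pow]; exact pow_lt_one₀ (norm_nonneg _) hq two_ne_zero

theorem qPoch_eq_mul_sq (a : ℂ) {q : ℂ} (hq : ‖q‖ < 1) :
    qPoch a q = qPoch a (q ^ 2) * qPoch (q * a) (q ^ 2) := by
  have h1 : ∀ i : ℕ, 1 - q ^ (2 * i) * a = 1 - (q ^ 2) ^ i * a := fun i => by rw [pow_mul]
  have h2 : ∀ i : ℕ, 1 - q ^ (2 * i + 1) * a = 1 - (q ^ 2) ^ i * (q * a) := fun i => by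
    rw [pow_add, pow_mul]; ring
  have := tprod_even_mul_odd (f := fun i : ℕ => 1 - q ^ i * a)
    (by simpa only [h1] using multipliable_qPoch a (norm_sq_lt_one hq))
    (by simpa only [h2] using multipliable_qPoch (q * a) (norm_sq_lt_one hq))
  simp only [h1, h2] at this
  exact this.symm

theorem qPoch_mul_qPoch_neg (a : ℂ) {q : ℂ} (hq : ‖q‖ < 1) :
    qPoch a q * qPoch (-a) q = qPoch (a ^ 2) (q ^ 2) := by
  rw [qPoch, qPoch, ← (multipliable_qPoch a hq).tprod_mul (multipliable_qPoch (-a) hq), qPoch]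
  exact tprod_congr fun i => by rw [pow_right_comm]; ring

theorem qPoch_self_ne_zero {q : ℂ} (hq : ‖q‖ < 1) : qPoch q q ≠ 0 := by
  refine qPoch_ne_zero hq fun i h => ?_
  have : ‖q ^ i * q‖ < 1 := by
    rw [← pow_succ, norm_pow]; exact pow_lt_one₀ (norm_nonneg _) hq (by simp)
  rw [h] at this; simp at this

end Pochhammer

/-! ### Theta products and their quasiperiodicity. -/

section Theta

/-- The theta product `(x, p / x; p)_∞`. -/
def theta (x p : ℂ) : ℂ := qPoch x p * qPoch (p / x) p

variable {p : ℂ}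

theorem theta_div (x : ℂ) (hp0 : p ≠ 0) : theta (p / x) p = theta x p := by
  rw [theta, theta, div_div_cancel₀ hp0, mul_comm]

theorem theta_mul (hp0 : p ≠ 0) (hp1 : ‖p‖ < 1) {x : ℂ} (hx : x ≠ 0) :
    theta (p * x) p = -x⁻¹ * theta x p := by
  rw [theta, theta, qPoch_eq_one_sub_mul x hp1, qPoch_eq_one_sub_mul (p / (p * x)) hp1]
  have h1 : p / (p * x) = x⁻¹ := by field_simp
  have h2 : p * x⁻¹ = p / x := rfl
  rw [h1, h2]
  field_simp
  ring

theorem theta_inv (hp0 : p ≠ 0) (hp1 : ‖p‖ < 1) {x : ℂ} (hx : x ≠ 0) :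
    theta x⁻¹ p = -x⁻¹ * theta x p := by
  rw [← theta_mul hp0 hp1 hx, ← theta_div (p * x) hp0]
  congr 1
  field_simp

theorem theta_eq_one_sub_mul (hp1 : ‖p‖ < 1) (x : ℂ) :
    theta x p = (1 - x) * (qPoch (p * x) p * qPoch (p / x) p) := by
  rw [theta, qPoch_eq_one_sub_mul x hp1, mul_assoc]

theorem theta_ne_zero (hp1 : ‖p‖ < 1) {x : ℂ} (hx0 : x ≠ 0) (hx : ∀ n : ℤ, x ≠ p ^ n) :
    theta x p ≠ 0 := by
  refine mul_ne_zero (qPoch_ne_zero hp1 fun i h => ?_) (qPoch_ne_zero hp1 fun i h => ?_)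
  · apply hx (-(i : ℤ))
    rw [zpow_neg, zpow_natCast]
    exact eq_inv_of_mul_eq_one_right h
  · apply hx ((i : ℤ) + 1)
    rw [← Nat.cast_succ, zpow_natCast, pow_succ]
    rw [← mul_div_assoc, div_eq_one_iff_eq hx0] at h
    exact h.symm

theorem theta_ne_zero_of_norm (hp1 : ‖p‖ < 1) {x : ℂ} (h1 : ‖p‖ < ‖x‖) (h2 : ‖x‖ < 1) :
    theta x p ≠ 0 := by
  have hx0 : x ≠ 0 := norm_pos_iff.1 ((norm_nonneg p).trans_lt h1)
  refine mul_ne_zero (qPoch_ne_zero hp1 fun i h => ?_) (qPoch_ne_zero hp1 fun i h => ?_)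
  · have := congrArg norm h
    rw [norm_mul, norm_pow, norm_one] at this
    have h3 : ‖p‖ ^ i ≤ 1 := pow_le_one₀ (norm_nonneg _) hp1.le
    nlinarith [norm_nonneg x]
  · have := congrArg norm h
    rw [norm_mul, norm_pow, norm_one, norm_div] at this
    have h3 : ‖p‖ ^ i ≤ 1 := pow_le_one₀ (norm_nonneg _) hp1.le
    have h4 : ‖p‖ / ‖x‖ < 1 := (div_lt_one ((norm_nonneg p).trans_lt h1)).2 h1
    have h5 : 0 ≤ ‖p‖ / ‖x‖ := by positivity
    nlinarith

theorem analyticAt_theta (hp1 : ‖p‖ < 1) {x : ℂ} (hx : x ≠ 0) :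
    AnalyticAt ℂ (fun x => theta x p) x := by
  refine (analyticAt_qPoch hp1 x).mul ?_
  exact AnalyticAt.comp (g := fun a => qPoch a p) (f := fun x => p / x) (analyticAt_qPoch hp1 _)
    (analyticAt_const.div analyticAt_id hx)

theorem analyticAt_theta_const_mul (hp1 : ‖p‖ < 1) {c x : ℂ} (hc : c ≠ 0) (hx : x ≠ 0) :
    AnalyticAt ℂ (fun x => theta (c * x) p) x :=
  AnalyticAt.comp (g := fun x => theta x p) (f := fun x => c * x)
    (analyticAt_theta hp1 (mul_ne_zero hc hx)) (by fun_prop)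

/-- The pole of the reciprocal theta product at `1`. -/
theorem poleAt_inv_theta (hp1 : ‖p‖ < 1) :
    PoleAt (fun x => (theta x p)⁻¹) 1 (qPoch p p ^ 2)⁻¹ := by
  have h1 : AnalyticAt ℂ (fun x => (qPoch (p * x) p * qPoch (p / x) p)⁻¹) 1 := by
    refine AnalyticAt.inv (AnalyticAt.mul ?_ ?_) ?_
    · exact AnalyticAt.comp (g := fun a => qPoch a p) (f := fun x => p * x)
        (analyticAt_qPoch hp1 _) (by fun_prop)
    · exact AnalyticAt.comp (g := fun a => qPoch a p) (f := fun x => p / x)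
        (analyticAt_qPoch hp1 _) (analyticAt_const.div analyticAt_id one_ne_zero)
    · simpa using qPoch_self_ne_zero hp1
  refine (((poleAt_one_div 1).analytic_mul one_ne_zero h1).congr ?_).congr_residue ?_
  · refine Eventually.of_forall fun x => ?_
    simp only [theta_eq_one_sub_mul hp1 x, mul_inv, div_one, one_div]
    ring
  · simp [sq]

theorem theta_sq (x : ℂ) {q : ℂ} (hq : ‖q‖ < 1) (hq0 : q ≠ 0) :
    theta x q = theta x (q ^ 2) * theta (q * x) (q ^ 2) := by
  have h1 : q ^ 2 / (q * x) = q / x := by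
    rw [sq, mul_div_mul_left _ _ hq0]
  have h2 : q * (q / x) = q ^ 2 / x := by ring
  rw [theta, theta, theta, qPoch_eq_mul_sq x hq, qPoch_eq_mul_sq (q / x) hq, h1, h2]
  ring

/-- Here `theta (-1) q = 2 (-q; q)_∞²`, and `(q; q)_∞ (-q; q)_∞ = (q²; q²)_∞`. This is the source of
the factor `2` in front of the theta quotient. -/
theorem theta_neg_one_mul {q : ℂ} (hq : ‖q‖ < 1) :
    theta (-1) q * qPoch q q ^ 2 = 2 * qPoch (q ^ 2) (q ^ 2) ^ 2 := by
  rw [theta_eq_one_sub_mul hq, ← qPoch_mul_qPoch_neg q hq]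
  simp only [mul_neg, mul_one, div_neg, div_one]
  ring

end Theta

/-! ### Theta series and Jacobi's triple product. -/

section TripleProduct

/-- For `n ≥ 0` the term is `(Q ^ n * M) ^ n`, eventually below `(1 / 2) ^ n`. The exponent
`k.natAbs` lets one `M` dominate both `‖u‖` and `‖u‖⁻¹`. -/
theorem summable_zpow_sq_mul {Q : ℝ} (hQ0 : 0 < Q) (hQ1 : Q < 1) (M : ℝ) (hM : 0 ≤ M) :
    Summable fun k : ℤ => Q ^ (k ^ 2) * M ^ k.natAbs := by
  have hN : Summable fun n : ℕ => Q ^ ((n : ℤ) ^ 2) * M ^ n := by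
    have h0 : Tendsto (fun n : ℕ => Q ^ n * M) atTop (𝓝 0) := by
      simpa using (tendsto_pow_atTop_nhds_zero_of_lt_one hQ0.le hQ1).mul_const M
    have h1 : ∀ᶠ n : ℕ in atTop, Q ^ n * M < 1 / 2 := h0.eventually_lt_const (by norm_num)
    refine Summable.of_norm_bounded_eventually_nat (g := fun n : ℕ => (1 / 2 : ℝ) ^ n)
      (summable_geometric_of_lt_one (by norm_num) (by norm_num)) ?_
    filter_upwards [h1] with n hn
    have h2 : Q ^ ((n : ℤ) ^ 2) * M ^ n = (Q ^ n * M) ^ n := by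
      rw [mul_pow, ← pow_mul, ← sq]; norm_cast
    rw [h2, Real.norm_of_nonneg (by positivity)]
    exact pow_le_pow_left₀ (by positivity) hn.le n
  refine Summable.of_nat_of_neg (by simpa using hN) (by simpa using hN)

theorem norm_zpow_le {u : ℂ} {M : ℝ} (h1 : ‖u‖ ≤ M) (h2 : ‖u‖⁻¹ ≤ M) (k : ℤ) :
    ‖u ^ k‖ ≤ M ^ k.natAbs := by
  rw [norm_zpow]
  obtain ⟨n, rfl | rfl⟩ := k.eq_nat_or_neg
  · simpa using pow_le_pow_left₀ (norm_nonneg _) h1 n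
  · simpa using pow_le_pow_left₀ (inv_nonneg.2 (norm_nonneg _)) h2 n

/-- The coefficient `(-1) ^ k q ^ (k²) u ^ k` of the theta series. -/
def thetaTerm (q u : ℂ) (k : ℤ) : ℂ := (-1) ^ k * q ^ (k ^ 2) * u ^ k

theorem norm_thetaTerm_le {q u : ℂ} {M : ℝ} (h1 : ‖u‖ ≤ M) (h2 : ‖u‖⁻¹ ≤ M) (k : ℤ) :
    ‖thetaTerm q u k‖ ≤ ‖q‖ ^ (k ^ 2) * M ^ k.natAbs := by
  rw [thetaTerm, norm_mul, norm_mul, norm_zpow, norm_zpow]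
  simp only [norm_neg, norm_one, one_zpow, one_mul]
  gcongr
  exact norm_zpow_le h1 h2 k

theorem summable_norm_thetaTerm {q : ℂ} (hq0 : q ≠ 0) (hq1 : ‖q‖ < 1) (u : ℂ) :
    Summable fun k : ℤ => ‖thetaTerm q u k‖ :=
  Summable.of_nonneg_of_le (fun _ => norm_nonneg _)
    (norm_thetaTerm_le (le_max_left ‖u‖ ‖u‖⁻¹) (le_max_right _ _))
    (summable_zpow_sq_mul (norm_pos_iff.2 hq0) hq1 _ (le_max_of_le_left (norm_nonneg _)))

theorem thetaTerm_add_one {q u : ℂ} (hq0 : q ≠ 0) (hu : u ≠ 0) (k : ℤ) :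
    thetaTerm q u (k + 1) = -(q * u) * (q ^ 2) ^ k * thetaTerm q u k := by
  have h1 : q ^ ((k + 1) ^ 2) = q ^ (k ^ 2) * (q ^ 2) ^ k * q := by
    rw [← zpow_natCast q 2, ← zpow_mul, ← zpow_add₀ hq0, ← zpow_add_one₀ hq0]
    congr 1; push_cast; ring
  rw [thetaTerm, thetaTerm, h1, zpow_add_one₀ hu, zpow_add_one₀ (by norm_num)]
  ring

/-- The reciprocal `1 / ((1 - p) ⋯ (1 - p ^ m))`, zero for negative `m`. -/
def qFactInv (p : ℂ) : ℤ → ℂ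
  | Int.ofNat n => (∏ i ∈ Finset.range n, (1 - p ^ i * p))⁻¹
  | Int.negSucc _ => 0

theorem one_sub_pow_ne_zero {p : ℂ} (hp1 : ‖p‖ < 1) (i : ℕ) : 1 - p ^ i * p ≠ 0 := by
  intro h
  have : ‖p ^ i * p‖ < 1 := by
    rw [← pow_succ, norm_pow]; exact pow_lt_one₀ (norm_nonneg _) hp1 (by simp)
  rw [← sub_eq_zero.1 h] at this; simp at this

/-- The convention of zero at negative arguments keeps the recursion valid over all of `ℤ`: at `m =
-1` the factor `1 - p ^ 0` vanishes. The finite identity can then be summed over `ℤ` without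
boundary terms. -/
theorem qFactInv_eq {p : ℂ} (hp1 : ‖p‖ < 1) (m : ℤ) :
    qFactInv p m = (1 - p ^ (m + 1)) * qFactInv p (m + 1) := by
  rcases m with n | _ | n
  · have h : Int.ofNat n + 1 = Int.ofNat (n + 1) := rfl
    rw [h, qFactInv, qFactInv, Finset.prod_range_succ, mul_inv, Int.ofNat_eq_natCast,
      zpow_natCast, pow_succ]
    rw [mul_left_comm, mul_inv_cancel₀ (one_sub_pow_ne_zero hp1 n), mul_one]
  · simp [qFactInv]
  · have h : Int.negSucc (n + 1) + 1 = Int.negSucc n := rfl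
    rw [h, qFactInv, qFactInv, mul_zero]

theorem tendsto_qFactInv {p : ℂ} (hp1 : ‖p‖ < 1) :
    Tendsto (qFactInv p) atTop (𝓝 (qPoch p p)⁻¹) := by
  rw [← Nat.map_cast_int_atTop, tendsto_map'_iff]
  exact (multipliable_qPoch p hp1).hasProd.tendsto_prod_nat.inv₀ (qPoch_self_ne_zero hp1)

theorem exists_norm_qFactInv_le {p : ℂ} (hp1 : ‖p‖ < 1) : ∃ C, ∀ m, ‖qFactInv p m‖ ≤ C := by
  have h : Tendsto (fun n : ℕ => qFactInv p (n : ℤ)) atTop (𝓝 (qPoch p p)⁻¹) :=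
    (tendsto_qFactInv hp1).comp tendsto_natCast_atTop_atTop
  obtain ⟨C, hC⟩ := (Metric.isBounded_range_of_tendsto _ h).exists_norm_le
  refine ⟨C, fun m => ?_⟩
  rcases m with n | n
  · exact hC _ ⟨n, rfl⟩
  · simpa [qFactInv] using (norm_nonneg _).trans (hC _ ⟨0, rfl⟩)

/-- A finite form of the triple product identity. -/
theorem hasSum_finite_tripleProduct {q u : ℂ} (hq0 : q ≠ 0) (hq1 : ‖q‖ < 1) (hu : u ≠ 0) (n : ℕ) :
    HasSum (fun k : ℤ => thetaTerm q u k * (∏ i ∈ Finset.range (2 * n), (1 - (q ^ 2) ^ i * q ^ 2))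
        * (qFactInv (q ^ 2) (n - k) * qFactInv (q ^ 2) (n + k)))
      (∏ i ∈ Finset.range n, (1 - (q ^ 2) ^ i * (q * u)) * (1 - (q ^ 2) ^ i * (q / u))) := by
  set p := q ^ 2 with hp
  have hp0 : p ≠ 0 := pow_ne_zero _ hq0
  have hp1 : ‖p‖ < 1 := norm_sq_lt_one hq1
  induction n with
  | zero =>
    convert hasSum_single (0 : ℤ) ?_ using 1
    · simp [thetaTerm, qFactInv]
    · intro k hk
      rcases lt_or_gt_of_ne hk with h | h
      · obtain ⟨m, rfl⟩ := Int.eq_negSucc_of_lt_zero h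
        simp [qFactInv]
      · obtain ⟨m, hm⟩ := Int.eq_negSucc_of_lt_zero (neg_lt_zero.2 h)
        simp [hm, qFactInv]
  | succ n ih =>
    have ih1 := (Equiv.addRight (1 : ℤ)).hasSum_iff.2 ih
    have ih2 := (Equiv.subRight (1 : ℤ)).hasSum_iff.2 ih
    -- Multiplying by the next two factors gives three terms, and those in `u` and `u⁻¹` are
    -- absorbed by shifting `k`. In the variables `X`, `Y`, `A`, `B` below, the termwise comparison
    -- is a rational identity.
    have := ((ih.mul_left (1 + p ^ (2 * n + 1))).sub (ih2.mul_left (p ^ n * (q * u)))).sub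
      (ih1.mul_left (p ^ n * (q / u)))
    have h1 : (1 - p ^ n * (q * u)) * (1 - p ^ n * (q / u))
        = 1 + p ^ (2 * n + 1) - p ^ n * (q * u) - p ^ n * (q / u) := by
      field_simp
      rw [hp]; ring
    rw [← sub_mul, ← sub_mul, ← h1,
      mul_comm ((1 - p ^ n * (q * u)) * (1 - p ^ n * (q / u))), ← Finset.prod_range_succ
      (fun i => (1 - p ^ i * (q * u)) * (1 - p ^ i * (q / u)))] at this
    refine this.congr_fun fun k => ?_
    simp only [Function.comp_apply, Equiv.coe_addRight, Equiv.subRight_apply]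
    have e1 : thetaTerm q u (k + 1) * (q / u) = -p ^ (k + 1) * thetaTerm q u k := by
      rw [thetaTerm_add_one hq0 hu, zpow_add_one₀ hp0, ← hp]; field_simp; rw [hp]; ring
    have e2 : thetaTerm q u (k - 1) * (q * u) = -p ^ (1 - k) * thetaTerm q u k := by
      have := thetaTerm_add_one hq0 hu (k - 1)
      rw [sub_add_cancel, ← hp] at this
      have h3 : p ^ (1 - k) * p ^ (k - 1) = 1 := by rw [← zpow_add₀ hp0]; simp
      rw [this]
      linear_combination (-(q * u) * thetaTerm q u (k - 1)) * h3
    set A := qFactInv p ((n : ℤ) + 1 - k) with hA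
    set B := qFactInv p ((n : ℤ) + 1 + k) with hB
    set X := p ^ ((n : ℤ) + 1 - k) with hX
    set Y := p ^ ((n : ℤ) + 1 + k) with hY
    have a1 : qFactInv p (n - k) = (1 - X) * A := by
      rw [qFactInv_eq hp1, show (n : ℤ) - k + 1 = n + 1 - k by ring]
    have a2 : qFactInv p (n - (k + 1)) = (1 - X / p) * ((1 - X) * A) := by
      rw [qFactInv_eq hp1, show (n : ℤ) - (k + 1) + 1 = n - k by ring, a1, hX,
        show (n : ℤ) - k = n + 1 - k - 1 by ring, zpow_sub_one₀ hp0]; rfl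
    have b1 : qFactInv p (n + k) = (1 - Y) * B := by
      rw [qFactInv_eq hp1, show (n : ℤ) + k + 1 = n + 1 + k by ring]
    have b2 : qFactInv p (n + (k - 1)) = (1 - Y / p) * ((1 - Y) * B) := by
      rw [qFactInv_eq hp1, show (n : ℤ) + (k - 1) + 1 = n + k by ring, b1, hY,
        show (n : ℤ) + k = n + 1 + k - 1 by ring, zpow_sub_one₀ hp0]; rfl
    have c1 : qFactInv p (n - (k - 1)) = A := by rw [hA]; congr 1; ring
    have c2 : qFactInv p (n + (k + 1)) = B := by rw [hB]; congr 1; ring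
    have f1 : p ^ n * p ^ (k + 1) = Y := by
      rw [hY, ← zpow_natCast, ← zpow_add₀ hp0]; congr 1; ring
    have f2 : p ^ n * p ^ (1 - k) = X := by
      rw [hX, ← zpow_natCast, ← zpow_add₀ hp0]; congr 1; ring
    have f3 : p ^ (2 * n + 1) = X * Y / p := by
      rw [hX, hY, ← zpow_add₀ hp0, div_eq_mul_inv, ← zpow_sub_one₀ hp0, ← zpow_natCast]
      congr 1; push_cast; ring
    have f4 : p ^ (2 * n) * p = X * Y / p := by rw [← f3]; ring
    have f5 : p ^ (2 * n + 1) * p = X * Y := by rw [f3]; field_simp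
    rw [show 2 * (n + 1) = 2 * n + 1 + 1 by ring, Finset.prod_range_succ,
      Finset.prod_range_succ, f4, f5, f3, Nat.cast_succ, a1, a2, b1, b2, c1, c2]
    generalize (∏ i ∈ Finset.range (2 * n), (1 - p ^ i * p)) = P
    have g1 : p ^ n * (q / u) * (thetaTerm q u (k + 1) * P * ((1 - X / p) * ((1 - X) * A) * B))
        = -Y * thetaTerm q u k * P * ((1 - X / p) * ((1 - X) * A) * B) := by
      linear_combination (p ^ n * P * ((1 - X / p) * ((1 - X) * A) * B)) * e1
        - (thetaTerm q u k * P * ((1 - X / p) * ((1 - X) * A) * B)) * f1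
    have g2 : p ^ n * (q * u) * (thetaTerm q u (k - 1) * P * (A * ((1 - Y / p) * ((1 - Y) * B))))
        = -X * thetaTerm q u k * P * (A * ((1 - Y / p) * ((1 - Y) * B))) := by
      linear_combination (p ^ n * P * (A * ((1 - Y / p) * ((1 - Y) * B)))) * e2
        - (thetaTerm q u k * P * (A * ((1 - Y / p) * ((1 - Y) * B)))) * f2
    rw [g1, g2]
    field_simp
    ring

/-- The theta series. -/
def thetaSum (q u : ℂ) : ℂ := ∑' k : ℤ, thetaTerm q u k

/-- **Jacobi's triple product identity**. -/
theorem thetaSum_eq {q u : ℂ} (hq0 : q ≠ 0) (hq1 : ‖q‖ < 1) (hu : u ≠ 0) :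
    thetaSum q u = qPoch (q ^ 2) (q ^ 2) * theta (q * u) (q ^ 2) := by
  have hp1 : ‖q ^ 2‖ < 1 := norm_sq_lt_one hq1
  have hP0 := qPoch_self_ne_zero hp1
  set p := q ^ 2 with hp
  set P : ℂ := qPoch p p with hP
  obtain ⟨C, hC⟩ := exists_norm_qFactInv_le hp1
  have hPlim : Tendsto (fun n : ℕ => ∏ i ∈ Finset.range (2 * n), (1 - p ^ i * p)) atTop (𝓝 P) :=
    (multipliable_qPoch p hp1).hasProd.tendsto_prod_nat.comp
      (tendsto_id.const_mul_atTop' two_pos)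
  obtain ⟨D, hD⟩ := (Metric.isBounded_range_of_tendsto _ hPlim).exists_norm_le
  have hC0 : 0 ≤ C := (norm_nonneg _).trans (hC 0)
  have hD0 : 0 ≤ D := (norm_nonneg _).trans (hD _ ⟨0, rfl⟩)
  -- Tannery's theorem: the weight of each `k` tends to `P * P⁻¹ * P⁻¹ = P⁻¹`, and is bounded by `D
  -- * (C * C)`.
  have hlim := tendsto_tsum_of_dominated_convergence (β := ℤ) (𝓕 := atTop)
    (f := fun (n : ℕ) (k : ℤ) => thetaTerm q u k *
      (∏ i ∈ Finset.range (2 * n), (1 - p ^ i * p)) * (qFactInv p (n - k) * qFactInv p (n + k)))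
    (g := fun k => thetaTerm q u k * P * (P⁻¹ * P⁻¹))
    (bound := fun k => ‖thetaTerm q u k‖ * D * (C * C))
    (((summable_norm_thetaTerm hq0 hq1 u).mul_right D).mul_right _)
    (fun k => by
      refine (hPlim.const_mul _).mul (Tendsto.mul ?_ ?_)
      · exact (tendsto_qFactInv hp1).comp
          (tendsto_atTop_add_const_right _ (-k) tendsto_natCast_atTop_atTop)
      · exact (tendsto_qFactInv hp1).comp
          (tendsto_atTop_add_const_right _ k tendsto_natCast_atTop_atTop))
    (Eventually.of_forall fun n k => by
      rw [norm_mul, norm_mul, norm_mul]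
      gcongr
      · exact hD _ ⟨n, rfl⟩
      · exact hC _
      · exact hC _)
  have hprod : Tendsto (fun n : ℕ => ∏ i ∈ Finset.range n, (1 - p ^ i * (q * u)) *
      (1 - p ^ i * (q / u))) atTop (𝓝 (theta (q * u) p)) := by
    have h1 : p / (q * u) = q / u := by rw [hp, sq, mul_div_mul_left _ _ hq0]
    rw [theta, h1]
    simp only [Finset.prod_mul_distrib]
    exact (multipliable_qPoch _ hp1).hasProd.tendsto_prod_nat.mul
      (multipliable_qPoch _ hp1).hasProd.tendsto_prod_nat
  have h2 := tendsto_nhds_unique hprod (hlim.congr fun n =>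
    (hasSum_finite_tripleProduct hq0 hq1 hu n).tsum_eq)
  rw [h2, tsum_mul_right, tsum_mul_right, thetaSum]
  field_simp

end TripleProduct

/-! ### Analyticity and poles of partial fraction series. -/

section PartialFractions

variable {p : ℂ}

/-- The ratio of the two sides tends to `1` as `e → ∞` and to `‖x‖` as `e → -∞`; only finitely many
nonzero ratios remain. The weight `1 + ‖p‖ ^ e` preserves the decay that large denominators provide
at negative exponents. -/
theorem exists_pos_le_norm_one_sub (hp0 : p ≠ 0) (hp1 : ‖p‖ < 1) {x : ℂ} (hx : x ≠ 0) :
    ∃ c > 0, ∀ e : ℤ, x * p ^ e ≠ 1 → c * (1 + ‖p‖ ^ e) ≤ ‖1 - x * p ^ e‖ := by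
  have hpn : 0 < ‖p‖ := norm_pos_iff.2 hp0
  have hxn : 0 < ‖x‖ := norm_pos_iff.2 hx
  have hpos : ∀ e : ℤ, 0 < 1 + ‖p‖ ^ e := fun e => by positivity
  set m : ℤ → ℝ := fun e => ‖1 - x * p ^ e‖ / (1 + ‖p‖ ^ e) with hm
  have hmul : ∀ (e : ℤ) (c : ℝ), c ≤ m e → c * (1 + ‖p‖ ^ e) ≤ ‖1 - x * p ^ e‖ :=
    fun e c h => (le_div_iff₀ (hpos e)).1 h
  suffices h : ∃ c > 0, ∀ e : ℤ, x * p ^ e ≠ 1 → c ≤ m e by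
    obtain ⟨c, hc, h⟩ := h
    exact ⟨c, hc, fun e he => hmul e c (h e he)⟩
  have htop : Tendsto (fun n : ℕ => p ^ n) atTop (𝓝 0) :=
    tendsto_pow_atTop_nhds_zero_of_norm_lt_one hp1
  have h1 : Tendsto (fun n : ℕ => m n) atTop (𝓝 1) := by
    have : Tendsto (fun n : ℕ => ‖1 - x * p ^ n‖ / (1 + ‖p ^ n‖)) atTop
        (𝓝 (‖1 - x * 0‖ / (1 + ‖(0 : ℂ)‖))) :=
      (tendsto_const_nhds.sub (htop.const_mul x)).norm.div
        (tendsto_const_nhds.add htop.norm) (by simp)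
    simpa [hm] using this
  have h2 : Tendsto (fun n : ℕ => m (-(n : ℤ))) atTop (𝓝 ‖x‖) := by
    have : Tendsto (fun n : ℕ => ‖p ^ n - x‖ / (‖p ^ n‖ + 1)) atTop
        (𝓝 (‖0 - x‖ / (‖(0 : ℂ)‖ + 1))) :=
      (htop.sub_const x).norm.div (htop.norm.add_const _) (by simp)
    simp only [zero_sub, norm_neg, norm_zero, zero_add, div_one] at this
    refine this.congr fun n => ?_
    have hpn' : p ^ n ≠ 0 := pow_ne_zero _ hp0
    have h3 : 1 - x * p ^ (-(n : ℤ)) = (p ^ n - x) / p ^ n := by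
      rw [zpow_neg, zpow_natCast]; field_simp
    have h4 : 1 + ‖p‖ ^ (-(n : ℤ)) = (‖p ^ n‖ + 1) / ‖p ^ n‖ := by
      rw [zpow_neg, zpow_natCast, norm_pow]; field_simp
    simp only [hm]
    rw [h3, h4, norm_div, div_div_div_cancel_right₀ (norm_ne_zero_iff.2 hpn')]
  have hδ1 : min 1 ‖x‖ / 2 < 1 := by
    have := min_le_left 1 ‖x‖
    linarith
  have hδ2 : min 1 ‖x‖ / 2 < ‖x‖ := by
    have := min_le_right 1 ‖x‖
    linarith
  have hδ : 0 < min 1 ‖x‖ / 2 := by positivity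
  obtain ⟨N, hN⟩ := eventually_atTop.1
    ((h1.eventually_const_lt hδ1).and (h2.eventually_const_lt hδ2))
  have hfin : ∀ F : Finset ℤ, ∃ c > 0, ∀ e ∈ F, x * p ^ e ≠ 1 → c ≤ m e := by
    intro F
    induction F using Finset.induction_on with
    | empty => exact ⟨1, one_pos, by simp⟩
    | insert e F _ ih =>
      obtain ⟨c, hc, h⟩ := ih
      by_cases he : x * p ^ e = 1
      · refine ⟨c, hc, fun e' he' hne => ?_⟩
        rcases Finset.mem_insert.1 he' with rfl | he'
        · exact absurd he hne
        · exact h e' he' hne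
      · have hme : 0 < m e :=
          div_pos (norm_pos_iff.2 (sub_ne_zero.2 (Ne.symm he))) (hpos e)
        refine ⟨min c (m e), lt_min hc hme, fun e' he' hne => ?_⟩
        rcases Finset.mem_insert.1 he' with rfl | he'
        · exact min_le_right _ _
        · exact (min_le_left _ _).trans (h e' he' hne)
  obtain ⟨c, hc, h⟩ := hfin (Finset.Icc (-(N : ℤ)) N)
  refine ⟨min c (min 1 ‖x‖ / 2), lt_min hc hδ, fun e he => ?_⟩
  by_cases heF : e ∈ Finset.Icc (-(N : ℤ)) N
  · exact (min_le_left _ _).trans (h e heF he)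
  · refine (min_le_right _ _).trans ?_
    rw [Finset.mem_Icc, not_and_or, not_le, not_le] at heF
    obtain ⟨n, rfl | rfl⟩ := e.eq_nat_or_neg
    · exact (hN n (by omega)).1.le
    · exact (hN n (by omega)).2.le

/-- Moving `x` by less than half the constant at `x₀` changes the denominator by at most half of the
lower bound. -/
theorem exists_pos_le_norm_one_sub_nhds (hp0 : p ≠ 0) (hp1 : ‖p‖ < 1) {x₀ : ℂ} (hx : x₀ ≠ 0) :
    ∃ c > 0, ∀ x ∈ Metric.ball x₀ c, ∀ e : ℤ, x₀ * p ^ e ≠ 1 →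
      c * (1 + ‖p‖ ^ e) ≤ ‖1 - x * p ^ e‖ := by
  obtain ⟨c, hc, h⟩ := exists_pos_le_norm_one_sub hp0 hp1 hx
  refine ⟨c / 2, by positivity, fun x hxb e he => ?_⟩
  have hpe : 0 < ‖p‖ ^ e := zpow_pos (norm_pos_iff.2 hp0) _
  have h1 := h e he
  have h2 : ‖(x - x₀) * p ^ e‖ ≤ c / 2 * ‖p‖ ^ e := by
    rw [norm_mul, norm_zpow]
    gcongr
    rw [← dist_eq_norm]
    exact (Metric.mem_ball.1 hxb).le
  have h3 : 1 - x * p ^ e = (1 - x₀ * p ^ e) - (x - x₀) * p ^ e := by ring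
  have h4 := norm_sub_norm_le (1 - x₀ * p ^ e) ((x - x₀) * p ^ e)
  rw [h3]
  nlinarith

theorem eventually_mul_zpow_ne_one (hp0 : p ≠ 0) (hp1 : ‖p‖ < 1) {x₀ : ℂ} (hx : x₀ ≠ 0) :
    ∀ᶠ x in 𝓝[≠] x₀, ∀ e : ℤ, x * p ^ e ≠ 1 := by
  obtain ⟨c, hc, h⟩ := exists_pos_le_norm_one_sub_nhds hp0 hp1 hx
  have hb : ∀ᶠ x in 𝓝[≠] x₀, x ∈ Metric.ball x₀ c :=
    (Metric.isOpen_ball.eventually_mem (Metric.mem_ball_self hc)).filter_mono nhdsWithin_le_nhds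
  filter_upwards [hb, self_mem_nhdsWithin] with x hxb hne e he
  by_cases he0 : x₀ * p ^ e = 1
  · exact hne (mul_right_cancel₀ (zpow_ne_zero e hp0) (he.trans he0.symm))
  · have := h x hxb e he0
    rw [he, sub_self, norm_zero] at this
    have hpe : 0 < 1 + ‖p‖ ^ e := by positivity
    nlinarith [mul_pos hc hpe]

variable {ι : Type*} {a : ι → ℂ} {e : ι → ℤ}

theorem norm_div_one_sub_le {c : ℝ} (hc : 0 < c) {b x : ℂ} {k : ℤ}
    (h : c * (1 + ‖p‖ ^ k) ≤ ‖1 - x * p ^ k‖) :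
    ‖b / (1 - x * p ^ k)‖ ≤ c⁻¹ * (‖b‖ / (1 + ‖p‖ ^ k)) := by
  have hpos : 0 < 1 + ‖p‖ ^ k := by positivity
  rw [norm_div]
  calc ‖b‖ / ‖1 - x * p ^ k‖ ≤ ‖b‖ / (c * (1 + ‖p‖ ^ k)) := by gcongr
    _ = _ := by field_simp

theorem summable_div_one_sub (hp0 : p ≠ 0) (hp1 : ‖p‖ < 1)
    (ha : Summable fun i => ‖a i‖ / (1 + ‖p‖ ^ e i)) {x : ℂ} (hx : x ≠ 0)
    (h : ∀ i, x * p ^ e i = 1 → a i = 0) : Summable fun i => a i / (1 - x * p ^ e i) := by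
  obtain ⟨c, hc, hb⟩ := exists_pos_le_norm_one_sub hp0 hp1 hx
  refine Summable.of_norm_bounded (ha.mul_left c⁻¹) fun i => ?_
  by_cases hi : x * p ^ e i = 1
  · simp [h i hi]
  · exact norm_div_one_sub_le hc (hb _ hi)

theorem analyticAt_tsum_div_one_sub (hp0 : p ≠ 0) (hp1 : ‖p‖ < 1)
    (ha : Summable fun i => ‖a i‖ / (1 + ‖p‖ ^ e i)) {x₀ : ℂ} (hx : x₀ ≠ 0)
    (h : ∀ i, x₀ * p ^ e i = 1 → a i = 0) :
    AnalyticAt ℂ (fun x => ∑' i, a i / (1 - x * p ^ e i)) x₀ := by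
  obtain ⟨c, hc, hb⟩ := exists_pos_le_norm_one_sub_nhds hp0 hp1 hx
  refine (Complex.differentiableOn_tsum_of_summable_norm (ha.mul_left c⁻¹) (fun i => ?_)
    Metric.isOpen_ball (fun i x hxb => ?_)).analyticAt (Metric.ball_mem_nhds x₀ hc)
  · by_cases hi : x₀ * p ^ e i = 1
    · simp only [h i hi, zero_div]
      exact differentiableOn_const _
    · intro x hxb
      have hne : 1 - x * p ^ e i ≠ 0 := by
        have hpos : 0 < c * (1 + ‖p‖ ^ e i) := by positivity
        exact norm_pos_iff.1 (hpos.trans_le (hb x hxb _ hi))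
      have hd : DifferentiableAt ℂ (fun x => 1 - x * p ^ e i) x := by fun_prop
      exact ((differentiableAt_const (a i)).fun_div hd hne).differentiableWithinAt
  · by_cases hi : x₀ * p ^ e i = 1
    · simp [h i hi]
    · exact norm_div_one_sub_le hc (hb x hxb _ hi)

/-- Setting the coefficient at the single resonant index to zero leaves a series analytic at `x₀`;
the removed term is the polar part. -/
theorem poleAt_tsum_div_one_sub (hp0 : p ≠ 0) (hp1 : ‖p‖ < 1)
    (ha : Summable fun i => ‖a i‖ / (1 + ‖p‖ ^ e i)) {x₀ : ℂ} (hx : x₀ ≠ 0) {i₀ : ι}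
    (h₀ : x₀ * p ^ e i₀ = 1) (h : ∀ i, i ≠ i₀ → x₀ * p ^ e i ≠ 1) :
    PoleAt (fun x => ∑' i, a i / (1 - x * p ^ e i)) x₀ (a i₀) := by
  classical
  have ha' : Summable fun i => ‖Function.update a i₀ 0 i‖ / (1 + ‖p‖ ^ e i) := by
    refine Summable.of_nonneg_of_le (fun i => by positivity) (fun i => ?_) ha
    gcongr
    by_cases hi : i = i₀
    · simp [hi]
    · simp [hi]
  refine ⟨_, analyticAt_tsum_div_one_sub (a := Function.update a i₀ 0) hp0 hp1 ha' hx
    fun i hi => ?_, ?_⟩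
  · by_cases hi0 : i = i₀
    · simp [hi0]
    · exact absurd hi (h i hi0)
  · have hne : ∀ᶠ x in 𝓝[≠] x₀, x ≠ 0 := (isOpen_ne.eventually_mem hx).filter_mono nhdsWithin_le_nhds
    filter_upwards [eventually_mul_zpow_ne_one hp0 hp1 hx, hne] with x hxe hx0
    rw [(summable_div_one_sub hp0 hp1 ha hx0 fun i hi =>
      absurd hi (hxe _)).tsum_eq_add_tsum_ite i₀]
    congr 1
    · rw [eq_inv_of_mul_eq_one_right h₀, div_eq_mul_inv x]
    · refine tsum_congr fun i => ?_
      by_cases hi : i = i₀ <;> simp [hi]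

end PartialFractions

/-! ### Kronecker's series as a theta quotient. -/

section KroneckerFormula

theorem mul_zpow_ne_one_iff {q x : ℂ} (hq0 : q ≠ 0) :
    (∀ e : ℤ, x * q ^ e ≠ 1) ↔ ∀ n : ℤ, x ≠ q ^ n := by
  constructor
  · rintro h n rfl
    apply h (-n)
    rw [← zpow_add₀ hq0]; simp
  · intro h e he
    apply h (-e)
    rw [zpow_neg]
    exact eq_inv_of_mul_eq_one_left he

theorem zpow_ne_one {q : ℂ} (hq1 : ‖q‖ < 1) {n : ℤ} (hn : n ≠ 0) : q ^ n ≠ 1 := by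
  intro h
  have := congrArg norm h
  rw [norm_zpow, norm_one, zpow_eq_one_iff_right₀ (norm_nonneg q) hq1.ne] at this
  exact hn this

theorem mul_zpow_ne_one_of_norm {p x : ℂ} (hp0 : p ≠ 0) (h1 : ‖p‖ < ‖x‖) (h2 : ‖x‖ < 1) :
    ∀ e : ℤ, x * p ^ e ≠ 1 := by
  have hpn : 0 < ‖p‖ := norm_pos_iff.2 hp0
  have hp1 : ‖p‖ < 1 := h1.trans h2
  rw [mul_zpow_ne_one_iff hp0]
  rintro n rfl
  rw [norm_zpow] at h1 h2
  have h3 : ‖p‖ ^ (1 : ℤ) < ‖p‖ ^ n := by rwa [zpow_one]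
  have h4 : ‖p‖ ^ n < ‖p‖ ^ (0 : ℤ) := by rwa [zpow_zero]
  rw [zpow_lt_zpow_iff_right_of_lt_one₀ hpn hp1] at h3 h4
  omega

theorem theta_ne_zero_of_mul_zpow {p x : ℂ} (hp0 : p ≠ 0) (hp1 : ‖p‖ < 1) (hx0 : x ≠ 0)
    (hx : ∀ e : ℤ, x * p ^ e ≠ 1) : theta x p ≠ 0 :=
  theta_ne_zero hp1 hx0 ((mul_zpow_ne_one_iff hp0).1 hx)

theorem mul_mul_zpow_ne_one {p x : ℂ} (hp0 : p ≠ 0) (hx : ∀ e : ℤ, x * p ^ e ≠ 1) :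
    ∀ e : ℤ, p * x * p ^ e ≠ 1 := by
  intro e
  have := hx (e + 1)
  rwa [zpow_add_one₀ hp0, ← mul_assoc, mul_comm, ← mul_assoc] at this

/-- Kronecker's series `∑ y ^ n / (1 - x q ^ n)`. -/
def kronSum (q y x : ℂ) : ℂ := ∑' n : ℤ, y ^ n / (1 - x * q ^ n)

variable {q y : ℂ}

theorem summable_kronWeight (hq0 : q ≠ 0) (hqy : ‖q‖ < ‖y‖) (hy : ‖y‖ < 1) :
    Summable fun n : ℤ => ‖y ^ n‖ / (1 + ‖q‖ ^ n) := by
  have hqn : 0 < ‖q‖ := norm_pos_iff.2 hq0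
  have hyn : 0 < ‖y‖ := hqn.trans hqy
  refine Summable.of_nat_of_neg ?_ ?_
  · refine Summable.of_nonneg_of_le (fun n => by positivity) (fun n => ?_)
      (summable_geometric_of_lt_one hyn.le hy)
    rw [zpow_natCast, norm_pow]
    exact div_le_self (by positivity) (by simp [hqn.le])
  · refine Summable.of_nonneg_of_le (fun n => by positivity) (fun n => ?_)
      (summable_geometric_of_lt_one (r := ‖q‖ / ‖y‖) (by positivity) ((div_lt_one hyn).2 hqy))
    have h1 : 0 < ‖q‖ ^ n := by positivity
    have h2 : 0 < ‖y‖ ^ n := by positivity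
    rw [norm_zpow, zpow_neg, zpow_neg, zpow_natCast, zpow_natCast, div_pow]
    calc (‖y‖ ^ n)⁻¹ / (1 + (‖q‖ ^ n)⁻¹) ≤ (‖y‖ ^ n)⁻¹ / (‖q‖ ^ n)⁻¹ := by gcongr; linarith
      _ = ‖q‖ ^ n / ‖y‖ ^ n := by field_simp

theorem kronSum_mul (hq0 : q ≠ 0) (hy0 : y ≠ 0) (x : ℂ) :
    kronSum q y (q * x) = y⁻¹ * kronSum q y x := by
  rw [kronSum, kronSum, ← (Equiv.addRight (1 : ℤ)).tsum_eq fun n => y ^ n / (1 - x * q ^ n),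
    ← tsum_mul_left]
  refine tsum_congr fun n => ?_
  rw [Equiv.coe_addRight, zpow_add_one₀ hy0, zpow_add_one₀ hq0]
  have : q * x * q ^ n = x * (q ^ n * q) := by ring
  rw [this]
  field_simp

/-- **Kronecker's formula** for `∑ y ^ n / (1 - x q ^ n)` as a quotient of theta products. -/
theorem kronSum_eq (hq0 : q ≠ 0) (hqy : ‖q‖ < ‖y‖) (hy : ‖y‖ < 1) {x : ℂ}
    (hx0 : x ≠ 0) (hx : ∀ e : ℤ, x * q ^ e ≠ 1) :
    kronSum q y x = qPoch q q ^ 2 * theta (y * x) q / (theta x q * theta y q) := by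
  have hq1 : ‖q‖ < 1 := hqy.trans hy
  have hqn : 0 < ‖q‖ := norm_pos_iff.2 hq0
  have hy0 : y ≠ 0 := norm_pos_iff.1 (hqn.trans hqy)
  have hθy : theta y q ≠ 0 := theta_ne_zero_of_norm hq1 hqy hy
  have hQ : qPoch q q ≠ 0 := qPoch_self_ne_zero hq1
  have hW := summable_kronWeight hq0 hqy hy
  set R : ℂ → ℂ := fun x => qPoch q q ^ 2 / theta y q * theta (y * x) q * (theta x q)⁻¹ with hR
  set g : ℂ → ℂ := fun x => kronSum q y x - R x with hg
  have hRan : ∀ a : ℂ, a ≠ 0 → AnalyticAt ℂ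
      (fun x => qPoch q q ^ 2 / theta y q * theta (y * x) q) a := fun a ha =>
    analyticAt_const.mul (analyticAt_theta_const_mul hq1 hy0 ha)
  have hreg : ∀ a : ℂ, a ≠ 0 → (∀ e : ℤ, a * q ^ e ≠ 1) → AnalyticAt ℂ g a := by
    intro a ha hae
    refine AnalyticAt.sub (analyticAt_tsum_div_one_sub (e := id) hq0 hq1 hW ha
      fun i hi => absurd hi (hae i)) ((hRan a ha).mul ((analyticAt_theta hq1 ha).inv ?_))
    exact theta_ne_zero_of_mul_zpow hq0 hq1 ha hae
  have hfe : ∀ a, a ≠ 0 → ∀ᶠ x in 𝓝[≠] a, g (q * x) = y⁻¹ * g x := by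
    intro a ha
    have hne : ∀ᶠ x in 𝓝[≠] a, x ≠ 0 := (isOpen_ne.eventually_mem ha).filter_mono nhdsWithin_le_nhds
    filter_upwards [hne] with x hx
    have h1 : y * (q * x) = q * (y * x) := by ring
    simp only [hg, hR]
    rw [kronSum_mul hq0 hy0, h1, theta_mul hq0 hq1 hx, theta_mul hq0 hq1 (mul_ne_zero hy0 hx),
      mul_sub, mul_inv, mul_inv]
    field_simp
  -- The poles form one orbit under multiplication by `q`, so cancellation at `1` is enough.
  have hpole1 : PoleAt g 1 0 := by
    have h1 : PoleAt (kronSum q y) 1 1 :=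
      (poleAt_tsum_div_one_sub (e := id) (i₀ := (0 : ℤ)) hq0 hq1 hW one_ne_zero (by simp)
        (fun i hi => by
          rw [one_mul]
          exact zpow_ne_one hq1 hi)).congr_residue (by simp)
    have h2 := (poleAt_inv_theta hq1).analytic_mul one_ne_zero (hRan 1 one_ne_zero)
    refine (h1.sub one_ne_zero h2).congr_residue ?_
    rw [mul_one]
    field_simp
    ring
  have hpole : ∀ a, a ≠ 0 → PoleAt g a 0 := by
    intro a ha
    by_cases h : ∀ e : ℤ, a * q ^ e ≠ 1
    · exact poleAt_of_analyticAt (hreg a ha h)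
    · rw [mul_zpow_ne_one_iff hq0] at h
      push Not at h
      obtain ⟨n, rfl⟩ := h
      have := PoleAt.zpow_mul hq0 (φ := fun _ => y⁻¹) (fun _ => analyticAt_const)
        (fun _ _ => inv_ne_zero hy0) hfe one_ne_zero hpole1 n
      rwa [mul_one] at this
  -- The annulus enters here: `‖q‖ < ‖y‖` makes `q * y⁻¹` small, and `‖y‖ < 1` prevents `y⁻¹` from
  -- being a nonnegative power of `q`.
  have hz := eq_zero_of_quasiperiodic hq0 hq1 hpole (φ := fun _ => y⁻¹) continuous_const
    (fun _ _ => inv_ne_zero hy0)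
    (by
      rw [← div_eq_mul_inv, norm_div]
      exact (div_lt_one (hqn.trans hqy)).2 hqy)
    (fun n h => by
      have h1 := congrArg norm h
      rw [norm_inv, norm_pow] at h1
      have h2 : ‖q‖ ^ n ≤ 1 := pow_le_one₀ hqn.le hq1.le
      have h3 : 1 < ‖y‖⁻¹ := (one_lt_inv₀ (hqn.trans hqy)).2 hy
      linarith) hfe hx0 (hreg x hx0 hx).continuousAt
  have : kronSum q y x = R x := sub_eq_zero.1 hz
  rw [this]
  simp only [hR]
  field_simp

end KroneckerFormula

/-! ### Functional equations and analyticity of the Lerch-type sums. -/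

section Lerch

/-- The Lerch-type sum `∑ (-1) ^ k q ^ (k²) u ^ k / (1 + q ^ (2 k) v)`. -/
def lerchSum (q u v : ℂ) : ℂ := ∑' k : ℤ, lerchTerm q u v k

variable {q : ℂ}

theorem lerchTerm_eq (q u v : ℂ) (k : ℤ) :
    lerchTerm q u v k = thetaTerm q u k / (1 - -v * (q ^ 2) ^ k) := by
  rw [lerchTerm, thetaTerm, zpow_mul]
  congr 1
  norm_cast
  ring

theorem summable_thetaWeight (hq0 : q ≠ 0) (hq1 : ‖q‖ < 1) (u : ℂ) :
    Summable fun k : ℤ => ‖thetaTerm q u k‖ / (1 + ‖q ^ 2‖ ^ k) :=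
  Summable.of_nonneg_of_le (fun k => by positivity)
    (fun k => div_le_self (norm_nonneg _) (le_add_of_nonneg_right (by positivity)))
    (summable_norm_thetaTerm hq0 hq1 u)

theorem summable_lerchTerm (hq0 : q ≠ 0) (hq1 : ‖q‖ < 1) (u : ℂ) {v : ℂ} (hv0 : v ≠ 0)
    (hv : ∀ k : ℤ, -v * (q ^ 2) ^ k ≠ 1) : Summable (lerchTerm q u v) := by
  have := summable_div_one_sub (e := id) (pow_ne_zero 2 hq0) (norm_sq_lt_one hq1)
    (summable_thetaWeight hq0 hq1 u) (neg_ne_zero.2 hv0) (fun i hi => absurd hi (hv i))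
  exact this.congr fun k => (lerchTerm_eq q u v k).symm

theorem hasSum_thetaTerm (hq0 : q ≠ 0) (hq1 : ‖q‖ < 1) (u : ℂ) :
    HasSum (thetaTerm q u) (thetaSum q u) :=
  (summable_norm_thetaTerm hq0 hq1 u).of_norm.hasSum

/-- After the shift `k ↦ k + 1` both sums share the denominator `D`, and the shifted coefficient
carries the factor `D - 1` up to sign; the part without denominator is the theta series. -/
theorem lerchSum_mul_right (hq0 : q ≠ 0) (hq1 : ‖q‖ < 1) {u v : ℂ} (hu : u ≠ 0) (hv0 : v ≠ 0)
    (hv : ∀ k : ℤ, -v * (q ^ 2) ^ k ≠ 1) :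
    lerchSum q u (q ^ 2 * v) = thetaSum q u + q / u * v * lerchSum q u v := by
  have hp0 : q ^ 2 ≠ 0 := pow_ne_zero 2 hq0
  have h1 := (Equiv.addRight (1 : ℤ)).hasSum_iff.2 (summable_lerchTerm hq0 hq1 u hv0 hv).hasSum
  refine ((hasSum_thetaTerm hq0 hq1 u).add (h1.mul_left (q / u * v))).tsum_eq ▸ ?_
  refine tsum_congr fun k => ?_
  simp only [Function.comp_apply, Equiv.coe_addRight]
  rw [lerchTerm_eq, lerchTerm_eq, thetaTerm_add_one hq0 hu]
  have h2 : 1 - -v * (q ^ 2) ^ (k + 1) ≠ 0 := sub_ne_zero.2 (hv (k + 1)).symm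
  rw [zpow_add_one₀ hp0] at h2 ⊢
  have h3 : 1 - -(q ^ 2 * v) * (q ^ 2) ^ k = 1 - -v * ((q ^ 2) ^ k * q ^ 2) := by ring
  rw [h3]
  generalize (q ^ 2) ^ k = t at h2 ⊢
  generalize hD : 1 - -v * (t * q ^ 2) = D at h2
  have h4 : t * q ^ 2 * v = D - 1 := by rw [← hD]; ring
  have h5 : q / u * v * (-(q * u) * t * thetaTerm q u k / D)
      = -(t * q ^ 2 * v) * thetaTerm q u k / D := by field_simp
  rw [h5, h4]
  field_simp
  ring

/-- Termwise this is `t / (1 + v t) = v⁻¹ (1 - 1 / (1 + v t))` with `t = q ^ (2 k)`. -/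
theorem lerchSum_mul_left (hq0 : q ≠ 0) (hq1 : ‖q‖ < 1) {u v : ℂ} (hv0 : v ≠ 0)
    (hv : ∀ k : ℤ, -v * (q ^ 2) ^ k ≠ 1) :
    lerchSum q (q ^ 2 * u) v = v⁻¹ * (thetaSum q u - lerchSum q u v) := by
  have h1 := (summable_lerchTerm hq0 hq1 u hv0 hv).hasSum
  refine (((hasSum_thetaTerm hq0 hq1 u).sub h1).mul_left v⁻¹).tsum_eq ▸ ?_
  refine tsum_congr fun k => ?_
  have h2 : 1 - -v * (q ^ 2) ^ k ≠ 0 := sub_ne_zero.2 (hv k).symm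
  rw [lerchTerm_eq, lerchTerm_eq]
  have h3 : thetaTerm q (q ^ 2 * u) k = (q ^ 2) ^ k * thetaTerm q u k := by
    rw [thetaTerm, thetaTerm, mul_zpow]; ring
  rw [h3]
  generalize (q ^ 2) ^ k = t at h2 ⊢
  rw [← mul_right_inj' hv0, mul_inv_cancel_left₀ hv0, div_eq_mul_inv, div_eq_mul_inv]
  linear_combination thetaTerm q u k * mul_inv_cancel₀ h2

theorem lerchSum_inv (hq0 : q ≠ 0) {u v : ℂ} (hv0 : v ≠ 0) :
    lerchSum q u v = v⁻¹ * lerchSum q (q ^ 2 * u⁻¹) v⁻¹ := by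
  have hp0 : q ^ 2 ≠ 0 := pow_ne_zero 2 hq0
  rw [lerchSum, lerchSum, ← (Equiv.neg ℤ).tsum_eq (lerchTerm q u v), ← tsum_mul_left]
  refine tsum_congr fun k => ?_
  rw [Equiv.neg_apply, lerchTerm_eq, lerchTerm_eq, thetaTerm, thetaTerm, mul_zpow, inv_zpow',
    neg_sq, zpow_neg (q ^ 2)]
  have h1 : ((-1 : ℂ)) ^ (-k) = (-1) ^ k := by
    rw [zpow_neg, ← inv_zpow]; norm_num
  have ht : (q ^ 2) ^ k ≠ 0 := zpow_ne_zero _ hp0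
  rw [h1]
  generalize (q ^ 2) ^ k = t at ht ⊢
  have h2 : 1 - -v * t⁻¹ = (t + v) * t⁻¹ := by field_simp; ring
  have h3 : 1 - -v⁻¹ * t = (t + v) * v⁻¹ := by field_simp; ring
  rw [h2, h3, div_eq_mul_inv, div_eq_mul_inv, mul_inv, mul_inv, inv_inv, inv_inv]
  field_simp

theorem thetaSum_inv (hq0 : q ≠ 0) (hq1 : ‖q‖ < 1) {u : ℂ} (hu : u ≠ 0) :
    thetaSum q u⁻¹ = thetaSum q u := by
  rw [thetaSum_eq hq0 hq1 hu, thetaSum_eq hq0 hq1 (inv_ne_zero hu),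
    ← theta_div (q * u) (pow_ne_zero 2 hq0)]
  congr 2
  field_simp

theorem neg_inv_mul_zpow_ne_one {p v : ℂ} (hv : ∀ k : ℤ, -v * p ^ k ≠ 1) :
    ∀ k : ℤ, -v⁻¹ * p ^ k ≠ 1 := by
  intro k h
  apply hv (-k)
  rw [zpow_neg, ← inv_eq_one, mul_inv, inv_inv, ← neg_inv]
  exact h

/-- The substitution `k ↦ -k` brings in `q² u⁻¹`, and `lerchSum_mul_left` removes the `q²`. -/
theorem lerchSum_add_inv (hq0 : q ≠ 0) (hq1 : ‖q‖ < 1) {u v : ℂ} (hu : u ≠ 0) (hv0 : v ≠ 0)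
    (hv : ∀ k : ℤ, -v * (q ^ 2) ^ k ≠ 1) :
    lerchSum q u v + lerchSum q u⁻¹ v⁻¹ = thetaSum q u := by
  rw [lerchSum_inv hq0 hv0, lerchSum_mul_left hq0 hq1 (inv_ne_zero hv0)
    (neg_inv_mul_zpow_ne_one hv), thetaSum_inv hq0 hq1 hu]
  field_simp
  ring

theorem analyticAt_lerchSum_right (hq0 : q ≠ 0) (hq1 : ‖q‖ < 1) (u : ℂ) {v : ℂ} (hv0 : v ≠ 0)
    (hv : ∀ k : ℤ, -v * (q ^ 2) ^ k ≠ 1) : AnalyticAt ℂ (fun v => lerchSum q u v) v := by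
  have h := analyticAt_tsum_div_one_sub (e := id) (pow_ne_zero 2 hq0) (norm_sq_lt_one hq1)
    (summable_thetaWeight hq0 hq1 u) (neg_ne_zero.2 hv0) (fun i hi => absurd hi (hv i))
  have h2 := AnalyticAt.comp (f := fun v : ℂ => -v) h (by fun_prop)
  simpa only [lerchSum, lerchTerm_eq, Function.comp_def, id] using h2

theorem poleAt_lerchSum (hq0 : q ≠ 0) (hq1 : ‖q‖ < 1) (u : ℂ) :
    PoleAt (fun v => lerchSum q u v) (-1) 1 := by
  have h := poleAt_tsum_div_one_sub (e := id) (i₀ := (0 : ℤ)) (pow_ne_zero 2 hq0)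
    (norm_sq_lt_one hq1) (summable_thetaWeight hq0 hq1 u) one_ne_zero (by simp)
    (fun i hi => by
      rw [one_mul]
      exact zpow_ne_one (norm_sq_lt_one hq1) hi)
  have h1 := h.congr_point (b := -1 * -1) (by ring)
  refine ((h1.comp_const_mul (by norm_num)).congr ?_).congr_residue (by simp [thetaTerm])
  refine Eventually.of_forall fun v => ?_
  simp only [lerchSum, lerchTerm_eq, neg_one_mul, id]

theorem analyticAt_lerchSum_left (hq0 : q ≠ 0) (hq1 : ‖q‖ < 1) {u₀ v : ℂ} (hu : u₀ ≠ 0)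
    (hv0 : v ≠ 0) (hv : ∀ k : ℤ, -v * (q ^ 2) ^ k ≠ 1) :
    AnalyticAt ℂ (fun u => lerchSum q u v) u₀ := by
  obtain ⟨c, hc, hb⟩ := exists_pos_le_norm_one_sub (pow_ne_zero 2 hq0) (norm_sq_lt_one hq1)
    (neg_ne_zero.2 hv0)
  have hun : 0 < ‖u₀‖ := norm_pos_iff.2 hu
  -- On the ball of radius `‖u₀‖ / 2` this bounds both `‖u‖` and `‖u‖⁻¹`.
  set M := max (2 * ‖u₀‖) (2 * ‖u₀‖⁻¹) with hM
  have hM0 : 0 ≤ M := le_max_of_le_left (by positivity)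
  have hr : 0 < ‖u₀‖ / 2 := by positivity
  have hnorm : ∀ u ∈ Metric.ball u₀ (‖u₀‖ / 2), ‖u₀‖ / 2 < ‖u‖ ∧ ‖u‖ ≤ 2 * ‖u₀‖ := by
    intro u hu
    rw [Metric.mem_ball, dist_eq_norm] at hu
    have h1 := norm_sub_norm_le u u₀
    have h2 := norm_sub_norm_le u₀ u
    rw [norm_sub_rev] at h2
    constructor <;> linarith
  refine (Complex.differentiableOn_tsum_of_summable_norm
    ((summable_zpow_sq_mul (norm_pos_iff.2 hq0) hq1 M hM0).mul_left c⁻¹) (fun k => ?_)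
    Metric.isOpen_ball (fun k u hub => ?_)).analyticAt (Metric.ball_mem_nhds u₀ hr)
  · intro u hub
    have hu0 : u ≠ 0 := norm_pos_iff.1 (hr.trans (hnorm u hub).1)
    have : DifferentiableAt ℂ (fun u : ℂ => u ^ k) u := differentiableAt_zpow.2 (Or.inl hu0)
    exact ((this.const_mul _).div_const _).differentiableWithinAt
  · obtain ⟨h1, h2⟩ := hnorm u hub
    rw [lerchTerm_eq]
    refine (norm_div_one_sub_le hc (hb k (hv k))).trans ?_
    refine mul_le_mul_of_nonneg_left ?_ (by positivity)
    refine (div_le_self (norm_nonneg _) (le_add_of_nonneg_right (by positivity))).trans ?_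
    refine norm_thetaTerm_le (h2.trans (le_max_left _ _)) (le_trans ?_ (le_max_right _ _)) k
    rw [inv_le_comm₀ (hr.trans h1) (by positivity)]
    calc (2 * ‖u₀‖⁻¹)⁻¹ = ‖u₀‖ / 2 := by field_simp
      _ ≤ ‖u‖ := h1.le

end Lerch

/-! ### Change of base for normalised Lerch-type sums. -/

section ChangeOfBase

variable {q : ℂ}

theorem poleAt_inv_theta_const_mul {p : ℂ} (hp1 : ‖p‖ < 1) {c a : ℂ} (hc : c ≠ 0)
    (h : c * a = 1) : PoleAt (fun x => (theta (c * x) p)⁻¹) a (qPoch p p ^ 2)⁻¹ :=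
  ((poleAt_inv_theta hp1).congr_point h.symm).comp_const_mul hc

/-- The difference of two normalised Lerch-type sums with the same ratio of arguments is a
quotient of theta products. -/
theorem lerchSum_div_sub (hq0 : q ≠ 0) (hq1 : ‖q‖ < 1) {u w v : ℂ} (hu : u ≠ 0) (hw : w ≠ 0)
    (hv0 : v ≠ 0) (hθu : theta (q * u) (q ^ 2) ≠ 0) (hθw : theta (q * w) (q ^ 2) ≠ 0)
    (huw : ∀ k : ℤ, w / u * (q ^ 2) ^ k ≠ 1) (hv : ∀ k : ℤ, -v * (q ^ 2) ^ k ≠ 1)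
    (hwv : ∀ k : ℤ, -(w / u * v) * (q ^ 2) ^ k ≠ 1) :
    lerchSum q u v / thetaSum q u - lerchSum q w (w / u * v) / thetaSum q w =
      qPoch (q ^ 2) (q ^ 2) * theta (w / u) (q ^ 2)
          / (theta (q * u) (q ^ 2) * theta (w / q) (q ^ 2))
        * theta (-(w / q) * v) (q ^ 2)
        / (theta (-1 * v) (q ^ 2) * theta (-(w / u) * v) (q ^ 2)) := by
  have hp0 : q ^ 2 ≠ 0 := pow_ne_zero 2 hq0
  have hp1 : ‖q ^ 2‖ < 1 := norm_sq_lt_one hq1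
  have hP := qPoch_self_ne_zero hp1
  have hΘu : thetaSum q u ≠ 0 := by
    rw [thetaSum_eq hq0 hq1 hu]; exact mul_ne_zero hP hθu
  have hΘw : thetaSum q w ≠ 0 := by
    rw [thetaSum_eq hq0 hq1 hw]; exact mul_ne_zero hP hθw
  have hwu0 : w / u ≠ 0 := div_ne_zero hw hu
  have huw' : ∀ k : ℤ, u / w * (q ^ 2) ^ k ≠ 1 := fun k h => huw (-k) (by
    rw [zpow_neg, ← inv_eq_one, mul_inv, inv_inv, inv_div, h])
  have hwq0 : w / q ≠ 0 := div_ne_zero hw hq0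
  have hqw : theta (q * w) (q ^ 2) = -(w / q)⁻¹ * theta (w / q) (q ^ 2) := by
    rw [← theta_mul hp0 hp1 hwq0]; congr 1; field_simp
  have hqu : theta (q * u) (q ^ 2) = -(u / q)⁻¹ * theta (u / q) (q ^ 2) := by
    rw [← theta_mul hp0 hp1 (div_ne_zero hu hq0)]; congr 1; field_simp
  have huwinv : theta (u / w) (q ^ 2) = -(w / u)⁻¹ * theta (w / u) (q ^ 2) := by
    rw [← theta_inv hp0 hp1 hwu0, inv_div]
  have hθwq : theta (w / q) (q ^ 2) ≠ 0 := by
    intro h; rw [h, mul_zero] at hqw; exact hθw hqw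
  have hθwu : theta (w / u) (q ^ 2) ≠ 0 := theta_ne_zero_of_mul_zpow hp0 hp1 hwu0 huw
  have hTu := thetaSum_eq hq0 hq1 hu
  have hTw := thetaSum_eq hq0 hq1 hw
  have h10 : (-1 : ℂ) ≠ 0 := by norm_num
  have hn0 : -(w / u) ≠ 0 := neg_ne_zero.2 hwu0
  set B := qPoch (q ^ 2) (q ^ 2) * theta (w / u) (q ^ 2)
          / (theta (q * u) (q ^ 2) * theta (w / q) (q ^ 2)) with hB
  set T : ℂ → ℂ := fun v => B * theta (-(w / q) * v) (q ^ 2) with hT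
  set g : ℂ → ℂ := fun v => (thetaSum q u)⁻¹ * lerchSum q u v
    - (thetaSum q w)⁻¹ * lerchSum q w (w / u * v)
    - T v * ((theta (-1 * v) (q ^ 2))⁻¹ * (theta (-(w / u) * v) (q ^ 2))⁻¹) with hg
  have hTan : ∀ a, a ≠ 0 → AnalyticAt ℂ T a := fun a ha =>
    analyticAt_const.mul (analyticAt_theta_const_mul hp1 (neg_ne_zero.2 hwq0) ha)
  have hL2 : ∀ a, a ≠ 0 → (∀ k : ℤ, -(w / u * a) * (q ^ 2) ^ k ≠ 1) →
      AnalyticAt ℂ (fun v => lerchSum q w (w / u * v)) a := fun a ha h =>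
    AnalyticAt.comp (g := fun v => lerchSum q w v) (f := fun v => w / u * v)
      (analyticAt_lerchSum_right hq0 hq1 w (mul_ne_zero hwu0 ha) h) (by fun_prop)
  have hi1 : ∀ a, a ≠ 0 → (∀ k : ℤ, -a * (q ^ 2) ^ k ≠ 1) →
      AnalyticAt ℂ (fun v => (theta (-1 * v) (q ^ 2))⁻¹) a := fun a ha h =>
    (analyticAt_theta_const_mul hp1 h10 ha).inv
      (theta_ne_zero_of_mul_zpow hp0 hp1 (mul_ne_zero h10 ha) (by simpa using h))
  have hi2 : ∀ a, a ≠ 0 → (∀ k : ℤ, -(w / u * a) * (q ^ 2) ^ k ≠ 1) →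
      AnalyticAt ℂ (fun v => (theta (-(w / u) * v) (q ^ 2))⁻¹) a := fun a ha h =>
    (analyticAt_theta_const_mul hp1 hn0 ha).inv
      (theta_ne_zero_of_mul_zpow hp0 hp1 (mul_ne_zero hn0 ha) (by simpa using h))
  have hreg : ∀ a, a ≠ 0 → (∀ k : ℤ, -a * (q ^ 2) ^ k ≠ 1) →
      (∀ k : ℤ, -(w / u * a) * (q ^ 2) ^ k ≠ 1) → AnalyticAt ℂ g a := by
    intro a ha h1 h2
    exact ((analyticAt_const.mul (analyticAt_lerchSum_right hq0 hq1 u ha h1)).sub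
      (analyticAt_const.mul (hL2 a ha h2))).sub ((hTan a ha).mul ((hi1 a ha h1).mul (hi2 a ha h2)))
  -- Both normalised sums satisfy `L (q² v) = 1 + (q / u) v L v`, because `(q / w) (w / u) = q / u`.
  -- Hence the constants cancel in the difference.
  have hfe : ∀ a, a ≠ 0 → ∀ᶠ x in 𝓝[≠] a, g (q ^ 2 * x) = q / u * x * g x := by
    intro a ha
    have hne : ∀ᶠ x in 𝓝[≠] a, x ≠ 0 := (isOpen_ne.eventually_mem ha).filter_mono nhdsWithin_le_nhds
    have hev : ∀ c : ℂ, c ≠ 0 → ∀ᶠ x in 𝓝[≠] a, ∀ k : ℤ, c * x * (q ^ 2) ^ k ≠ 1 := fun c hc =>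
      (tendsto_const_mul_punctured hc).eventually
        (eventually_mul_zpow_ne_one hp0 hp1 (mul_ne_zero hc ha))
    filter_upwards [hne, hev _ h10, hev _ hn0] with x hx h1 h2
    have e1 : w / u * (q ^ 2 * x) = q ^ 2 * (w / u * x) := by ring
    have e2 : ∀ c : ℂ, c * (q ^ 2 * x) = q ^ 2 * (c * x) := fun c => by ring
    simp only [hg, hT]
    rw [e1, e2, e2, e2, lerchSum_mul_right hq0 hq1 hu hx (by simpa using h1),
      lerchSum_mul_right hq0 hq1 hw (mul_ne_zero hwu0 hx) (by simpa using h2),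
      theta_mul hp0 hp1 (mul_ne_zero h10 hx), theta_mul hp0 hp1 (mul_ne_zero hn0 hx),
      theta_mul hp0 hp1 (mul_ne_zero (neg_ne_zero.2 hwq0) hx),
      mul_inv _ (theta (-1 * x) (q ^ 2)), mul_inv _ (theta (-(w / u) * x) (q ^ 2))]
    have k1 : (thetaSum q u)⁻¹ * thetaSum q u = 1 := inv_mul_cancel₀ hΘu
    have k2 : (thetaSum q w)⁻¹ * thetaSum q w = 1 := inv_mul_cancel₀ hΘw
    have k3 : q / w * (w / u * x) = q / u * x := by field_simp
    have k4 : (-(-(w / q) * x)⁻¹) * ((-(-1 * x)⁻¹)⁻¹ * (-(-(w / u) * x)⁻¹)⁻¹) = q / u * x := by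
      field_simp
    rw [k3]
    generalize (theta (-1 * x) (q ^ 2))⁻¹ = A1
    generalize (theta (-(w / u) * x) (q ^ 2))⁻¹ = A2
    linear_combination k1 - k2 - B * theta (-(w / q) * x) (q ^ 2) * A1 * A2 * k4
  have hpole1 : PoleAt g (-1) 0 := by
    have c2 : ∀ k : ℤ, -(w / u * -1) * (q ^ 2) ^ k ≠ 1 := by simpa using huw
    have p1 := (poleAt_lerchSum hq0 hq1 u).const_mul h10 (thetaSum q u)⁻¹
    have p2 := (poleAt_of_analyticAt (hL2 _ h10 c2)).const_mul h10 (thetaSum q w)⁻¹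
    have p3 := (poleAt_inv_theta_const_mul hp1 h10 (show (-1 : ℂ) * -1 = 1 by ring)).analytic_mul
      h10 ((hTan _ h10).mul (hi2 _ h10 c2))
    refine (((p1.sub h10 p2).sub h10 p3).congr ?_).congr_residue ?_
    · refine Eventually.of_forall fun x => ?_
      simp only [hg, Pi.mul_apply]; ring
    · simp only [Pi.mul_apply, hT, hB, hTu, mul_neg, mul_one, neg_neg]
      field_simp
      ring
  -- The second orbit of poles: here the second sum is singular and the first is regular.
  have ha2 : -(u / w) ≠ 0 := neg_ne_zero.2 (div_ne_zero hu hw)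
  have hpole2 : PoleAt g (-(u / w)) 0 := by
    have c1 : ∀ k : ℤ, - -(u / w) * (q ^ 2) ^ k ≠ 1 := by simpa using huw'
    have p1 := (poleAt_of_analyticAt (analyticAt_lerchSum_right hq0 hq1 u ha2 c1)).const_mul ha2
      (thetaSum q u)⁻¹
    have p2 := (((poleAt_lerchSum hq0 hq1 w).congr_point
      (show -1 = w / u * -(u / w) by field_simp)).comp_const_mul hwu0).const_mul ha2
      (thetaSum q w)⁻¹
    have p3 := (poleAt_inv_theta_const_mul hp1 hn0
      (show -(w / u) * -(u / w) = 1 by field_simp)).analytic_mul ha2 ((hTan _ ha2).mul (hi1 _ ha2 c1))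
    refine (((p1.sub ha2 p2).sub ha2 p3).congr ?_).congr_residue ?_
    · refine Eventually.of_forall fun x => ?_
      simp only [hg, Pi.mul_apply]; ring
    · have e1 : -(w / q) * -(u / w) = u / q := by field_simp
      have e2 : -1 * -(u / w) = u / w := by ring
      simp only [Pi.mul_apply, hT, hB, hTw, e1, e2, hqw, hqu, huwinv]
      have hθuq : theta (u / q) (q ^ 2) ≠ 0 := by
        intro h; rw [h, mul_zero] at hqu; exact hθu hqu
      field_simp
      ring
  have hpole : ∀ a, a ≠ 0 → PoleAt g a 0 := by
    intro a ha
    have htr : ∀ b, b ≠ 0 → PoleAt g b 0 → ∀ n : ℤ, PoleAt g ((q ^ 2) ^ n * b) 0 :=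
      fun b hb hgb n => PoleAt.zpow_mul hp0 (φ := fun x => q / u * x) (fun _ => by fun_prop)
        (fun x hx => mul_ne_zero (div_ne_zero hq0 hu) hx) hfe hb hgb n
    by_cases h1 : ∀ k : ℤ, -a * (q ^ 2) ^ k ≠ 1
    · by_cases h2 : ∀ k : ℤ, -(w / u * a) * (q ^ 2) ^ k ≠ 1
      · exact poleAt_of_analyticAt (hreg a ha h1 h2)
      · rw [mul_zpow_ne_one_iff hp0] at h2
        push Not at h2
        obtain ⟨n, hn⟩ := h2
        refine (htr _ ha2 hpole2 n).congr_point ?_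
        rw [← hn]; field_simp
    · rw [mul_zpow_ne_one_iff hp0] at h1
      push Not at h1
      obtain ⟨n, hn⟩ := h1
      refine (htr _ h10 hpole1 n).congr_point ?_
      rw [← hn]; ring
  have hz := eq_zero_of_quasiperiodic hp0 hp1 hpole (φ := fun x => q / u * x) (by fun_prop)
    (fun x hx => mul_ne_zero (div_ne_zero hq0 hu) hx) (by simp)
    (fun n h => pow_ne_zero n hp0 (by simpa using h.symm)) hfe hv0
    (hreg v hv0 hv hwv).continuousAt
  simp only [hg, hT] at hz
  rw [sub_eq_zero] at hz
  rw [div_eq_inv_mul, div_eq_inv_mul, hz, ← mul_inv]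
  exact (div_eq_mul_inv _ _).symm

end ChangeOfBase

/-! ### Convergence, poles and functional equation of the double sum. -/

section DoubleSum

theorem tsum_prod_eq_tsum_succ_add {F : ℕ × ℕ → ℂ} (hF : Summable F) :
    ∑' p, F p = ∑' p : ℕ × ℕ, F (p.1 + 1, p.2 + 1) + ∑' s : ℕ, F (s, 0) + ∑' t : ℕ, F (0, t)
      - F (0, 0) := by
  have h1 : Summable fun p : ℕ × ℕ => F (p.1, p.2 + 1) :=
    hF.comp_injective (i := fun p : ℕ × ℕ => (p.1, p.2 + 1)) fun a b h => by
      simp only [Prod.mk.injEq, Nat.add_right_cancel_iff] at h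
      exact Prod.ext h.1 h.2
  have h2 : Summable fun p : ℕ × ℕ => F (p.1 + 1, p.2 + 1) :=
    hF.comp_injective (i := fun p : ℕ × ℕ => (p.1 + 1, p.2 + 1)) fun a b h => by
      simp only [Prod.mk.injEq, Nat.add_right_cancel_iff] at h
      exact Prod.ext h.1 h.2
  have h3 : Summable fun s : ℕ => F (s, 0) :=
    hF.comp_injective (i := fun s : ℕ => (s, 0)) fun a b h => by simpa using h
  have h4 : Summable fun t : ℕ => F (0, t) :=
    hF.comp_injective (i := fun t : ℕ => (0, t)) fun a b h => by simpa using h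
  have e1 : ∀ s : ℕ, ∑' t, F (s, t) = F (s, 0) + ∑' t, F (s, t + 1) := fun s =>
    (hF.comp_injective (i := fun t : ℕ => (s, t)) fun a b h => by simpa using h).tsum_eq_zero_add
  rw [hF.tsum_prod, tsum_congr e1, h3.tsum_add h1.prod, h1.prod.tsum_eq_zero_add, h2.tsum_prod,
    h4.tsum_eq_zero_add]
  ring

variable {q y z : ℂ}

/-- The numerator `q ^ (s t) y ^ s z ^ t`. -/
def num (q y z : ℂ) (s t : ℤ) : ℂ := q ^ (s * t) * y ^ s * z ^ t

theorem summable_num_nonneg (hq1 : ‖q‖ < 1) (hy : ‖y‖ < 1) (hz : ‖z‖ < 1) :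
    Summable fun p : ℕ × ℕ => ‖num q y z p.1 p.2‖ := by
  have h := (summable_geometric_of_lt_one (norm_nonneg y) hy).mul_of_nonneg
    (summable_geometric_of_lt_one (norm_nonneg z) hz) (fun _ => by positivity)
    (fun _ => by positivity)
  refine Summable.of_nonneg_of_le (fun p => norm_nonneg _) (fun p => ?_) h
  rw [num, norm_mul, norm_mul, ← Nat.cast_mul, zpow_natCast, zpow_natCast, zpow_natCast,
    norm_pow, norm_pow, norm_pow, mul_assoc]
  exact mul_le_of_le_one_left (by positivity) (pow_le_one₀ (norm_nonneg _) hq1.le)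

theorem summable_weight_nonneg (hq1 : ‖q‖ < 1) (hy : ‖y‖ < 1) (hz : ‖z‖ < 1) :
    Summable fun p : ℕ × ℕ => ‖num q y z p.1 p.2‖ / (1 + ‖q‖ ^ ((p.1 : ℤ) + p.2)) :=
  Summable.of_nonneg_of_le (fun k => by positivity)
    (fun k => div_le_self (norm_nonneg _) (le_add_of_nonneg_right (by positivity)))
    (summable_num_nonneg hq1 hy hz)

/-- The denominator grows like `‖q‖ ^ (-(m + n))`, which gives domination by a product of geometric
series with ratios `‖q‖ / ‖y‖` and `‖q‖ / ‖z‖`. -/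
theorem summable_weight_nonpos (hq0 : q ≠ 0) (hq1 : ‖q‖ < 1) (hqy : ‖q‖ < ‖y‖)
    (hqz : ‖q‖ < ‖z‖) :
    Summable fun p : ℕ × ℕ =>
      ‖num q y z (-(p.1 : ℤ)) (-(p.2 : ℤ))‖ / (1 + ‖q‖ ^ (-(p.1 : ℤ) + -(p.2 : ℤ))) := by
  have hqn : 0 < ‖q‖ := norm_pos_iff.2 hq0
  have hyn : 0 < ‖y‖ := hqn.trans hqy
  have hzn : 0 < ‖z‖ := hqn.trans hqz
  have h := (summable_geometric_of_lt_one (r := ‖q‖ / ‖y‖) (by positivity)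
    ((div_lt_one hyn).2 hqy)).mul_of_nonneg
    (summable_geometric_of_lt_one (r := ‖q‖ / ‖z‖) (by positivity) ((div_lt_one hzn).2 hqz))
    (fun _ => by positivity) (fun _ => by positivity)
  refine Summable.of_nonneg_of_le (fun p => by positivity) (fun p => ?_) h
  obtain ⟨m, n⟩ := p
  have e1 : num q y z (-(m : ℤ)) (-(n : ℤ)) = q ^ (m * n) * (y ^ m)⁻¹ * (z ^ n)⁻¹ := by
    rw [num, neg_mul_neg, zpow_neg, zpow_neg, ← Nat.cast_mul, zpow_natCast, zpow_natCast,
      zpow_natCast]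
  have e2 : ‖q‖ ^ (-(m : ℤ) + -(n : ℤ)) = (‖q‖ ^ m * ‖q‖ ^ n)⁻¹ := by
    rw [zpow_add₀ hqn.ne', zpow_neg, zpow_neg, zpow_natCast, zpow_natCast, mul_inv]
  simp only [e1, e2, norm_mul, norm_inv, norm_pow, div_pow]
  have hmn : ‖q‖ ^ (m * n) ≤ 1 := pow_le_one₀ hqn.le hq1.le
  have hm : 0 < ‖q‖ ^ m * ‖q‖ ^ n := by positivity
  calc ‖q‖ ^ (m * n) * (‖y‖ ^ m)⁻¹ * (‖z‖ ^ n)⁻¹ / (1 + (‖q‖ ^ m * ‖q‖ ^ n)⁻¹)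
      ≤ 1 * (‖y‖ ^ m)⁻¹ * (‖z‖ ^ n)⁻¹ / (‖q‖ ^ m * ‖q‖ ^ n)⁻¹ := by gcongr; linarith
    _ = ‖q‖ ^ m / ‖y‖ ^ m * (‖q‖ ^ n / ‖z‖ ^ n) := by field_simp

theorem succ_injective_prod : Function.Injective fun p : ℕ × ℕ => (p.1 + 1, p.2 + 1) :=
  fun a b h => by
    simp only [Prod.mk.injEq, Nat.add_right_cancel_iff] at h
    exact Prod.ext h.1 h.2

theorem summable_weight_neg (hq0 : q ≠ 0) (hq1 : ‖q‖ < 1) (hqy : ‖q‖ < ‖y‖)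
    (hqz : ‖q‖ < ‖z‖) :
    Summable fun p : ℕ × ℕ => ‖num q y z (-((p.1 : ℤ) + 1)) (-((p.2 : ℤ) + 1))‖ /
      (1 + ‖q‖ ^ (-((p.1 : ℤ) + 1) + -((p.2 : ℤ) + 1))) := by
  have := (summable_weight_nonpos hq0 hq1 hqy hqz).comp_injective succ_injective_prod
  simpa [Function.comp_def] using this

variable {x : ℂ}

theorem summable_termNonneg (hq0 : q ≠ 0) (hq1 : ‖q‖ < 1) (hy : ‖y‖ < 1) (hz : ‖z‖ < 1)
    (hx0 : x ≠ 0) (hx : ∀ e : ℤ, x * q ^ e ≠ 1) : Summable (termNonneg q x y z) :=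
  summable_div_one_sub (a := fun p : ℕ × ℕ => num q y z p.1 p.2) hq0 hq1
    (summable_weight_nonneg hq1 hy hz) hx0 fun _ h => absurd h (hx _)

theorem summable_term_nonpos (hq0 : q ≠ 0) (hq1 : ‖q‖ < 1) (hqy : ‖q‖ < ‖y‖) (hqz : ‖q‖ < ‖z‖)
    (hx0 : x ≠ 0) (hx : ∀ e : ℤ, x * q ^ e ≠ 1) :
    Summable fun p : ℕ × ℕ => term q x y z (-(p.1 : ℤ)) (-(p.2 : ℤ)) :=
  summable_div_one_sub (a := fun p : ℕ × ℕ => num q y z (-(p.1 : ℤ)) (-(p.2 : ℤ))) hq0 hq1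
    (summable_weight_nonpos hq0 hq1 hqy hqz) hx0 fun _ h => absurd h (hx _)

theorem summable_termNeg (hq0 : q ≠ 0) (hq1 : ‖q‖ < 1) (hqy : ‖q‖ < ‖y‖) (hqz : ‖q‖ < ‖z‖)
    (hx0 : x ≠ 0) (hx : ∀ e : ℤ, x * q ^ e ≠ 1) : Summable (termNeg q x y z) :=
  summable_div_one_sub
    (a := fun p : ℕ × ℕ => num q y z (-((p.1 : ℤ) + 1)) (-((p.2 : ℤ) + 1))) hq0 hq1
    (summable_weight_neg hq0 hq1 hqy hqz) hx0 fun _ h => absurd h (hx _)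

/-- The exponent `s + t` is at least `0` in one quadrant and at most `-2` in the other. It never
equals `-1`, so `x = q` is a regular point; this is used in the pole check there. -/
theorem analyticAt_doubleSum (hq0 : q ≠ 0) (hqy : ‖q‖ < ‖y‖) (hy : ‖y‖ < 1)
    (hqz : ‖q‖ < ‖z‖) (hz : ‖z‖ < 1) (hx0 : x ≠ 0)
    (hx : ∀ e : ℤ, e ≠ -1 → x * q ^ e ≠ 1) :
    AnalyticAt ℂ (fun x => doubleSum q x y z) x := by
  have hq1 := hqy.trans hy
  exact (analyticAt_tsum_div_one_sub (a := fun p : ℕ × ℕ => num q y z p.1 p.2) hq0 hq1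
    (summable_weight_nonneg hq1 hy hz) hx0 fun _ h => absurd h (hx _ (by omega))).sub
    (analyticAt_tsum_div_one_sub
      (a := fun p : ℕ × ℕ => num q y z (-((p.1 : ℤ) + 1)) (-((p.2 : ℤ) + 1))) hq0 hq1
      (summable_weight_neg hq0 hq1 hqy hqz) hx0 fun _ h => absurd h (hx _ (by omega)))

theorem poleAt_doubleSum (hq0 : q ≠ 0) (hqy : ‖q‖ < ‖y‖) (hy : ‖y‖ < 1)
    (hqz : ‖q‖ < ‖z‖) (hz : ‖z‖ < 1) : PoleAt (fun x => doubleSum q x y z) 1 1 := by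
  have hq1 := hqy.trans hy
  have h1 := poleAt_tsum_div_one_sub (a := fun p : ℕ × ℕ => num q y z p.1 p.2)
    (i₀ := (0, 0)) hq0 hq1 (summable_weight_nonneg hq1 hy hz) one_ne_zero (by simp)
    (fun p hp => by
      rw [one_mul]
      refine zpow_ne_one hq1 fun h => hp ?_
      ext <;> simp <;> omega)
  have h2 := analyticAt_tsum_div_one_sub
      (a := fun p : ℕ × ℕ => num q y z (-((p.1 : ℤ) + 1)) (-((p.2 : ℤ) + 1))) hq0 hq1
      (summable_weight_neg hq0 hq1 hqy hqz) one_ne_zero fun p h => by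
        rw [one_mul] at h
        exact absurd h (zpow_ne_one hq1 (by omega))
  refine (h1.sub one_ne_zero (poleAt_of_analyticAt h2)).congr_residue ?_
  simp [num]

theorem term_mul_sq (hq0 : q ≠ 0) (hy0 : y ≠ 0) (hz0 : z ≠ 0) (hx : ∀ e : ℤ, x * q ^ e ≠ 1)
    (s t : ℤ) : term q (q ^ 2 * x) y z s t
      = num q y z s t + q / (y * z) * x * term q x y z (s + 1) (t + 1) := by
  have h1 : q ^ ((s + 1) * (t + 1)) = q ^ (s * t) * q ^ (s + t) * q := by
    rw [← zpow_add₀ hq0, ← zpow_add_one₀ hq0]; congr 1; ring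
  have h2 : q ^ (s + 1 + (t + 1)) = q ^ (s + t) * q ^ 2 := by
    rw [← zpow_natCast q 2, ← zpow_add₀ hq0]; congr 1; push_cast; ring
  have h3 : 1 - x * q ^ (s + 1 + (t + 1)) ≠ 0 := sub_ne_zero.2 (hx _).symm
  rw [h2] at h3
  rw [term, term, num, h1, h2, zpow_add_one₀ hy0, zpow_add_one₀ hz0]
  generalize q ^ (s * t) = a
  generalize q ^ (s + t) = b at h3 ⊢
  have h4 : 1 - q ^ 2 * x * b = 1 - x * (b * q ^ 2) := by ring
  rw [h4]
  generalize hD : 1 - x * (b * q ^ 2) = D at h3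
  have h5 : x * (b * q ^ 2) = 1 - D := by rw [← hD]; ring
  have h6 : q / (y * z) * x * (a * b * q * (y ^ s * y) * (z ^ t * z) / D)
      = a * y ^ s * z ^ t * (x * (b * q ^ 2)) / D := by field_simp
  rw [h6, h5]
  field_simp
  ring

theorem summable_num_neg (hq0 : q ≠ 0) (hq1 : ‖q‖ < 1) (hqy : ‖q‖ < ‖y‖)
    (hqz : ‖q‖ < ‖z‖) :
    Summable fun p : ℕ × ℕ => num q y z (-((p.1 : ℤ) + 1)) (-((p.2 : ℤ) + 1)) := by
  have hqn : 0 < ‖q‖ := norm_pos_iff.2 hq0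
  have hy0 : y ≠ 0 := norm_pos_iff.1 (hqn.trans hqy)
  have hz0 : z ≠ 0 := norm_pos_iff.1 (hqn.trans hqz)
  -- An auxiliary nonresonant `x`: by `term_mul_sq` the numerators are differences of two families
  -- already known to be summable.
  obtain ⟨x, hx, hx0⟩ : ∃ x : ℂ, (∀ e : ℤ, x * q ^ e ≠ 1) ∧ x ≠ 0 :=
    ((eventually_mul_zpow_ne_one hq0 hq1 one_ne_zero).and
      ((isOpen_ne.eventually_mem one_ne_zero).filter_mono nhdsWithin_le_nhds)).exists
  have h1 := summable_termNeg hq0 hq1 hqy hqz (mul_ne_zero hq0 (mul_ne_zero hq0 hx0))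
    (mul_mul_zpow_ne_one hq0 (mul_mul_zpow_ne_one hq0 hx))
  have h2 := (summable_term_nonpos hq0 hq1 hqy hqz hx0 hx).mul_left (q / (y * z) * x)
  refine (h1.sub h2).congr fun p => ?_
  rw [termNeg, ← mul_assoc q q x, ← sq, term_mul_sq hq0 hy0 hz0 hx]
  simp

/-- Summing the geometric series in `t` leaves the terms of Kronecker's series. In the negative
quadrant the ratio is `r = q ^ (m + 1) / z`, and `-r / (r - 1)` turns into `-1 / (1 - r⁻¹)`, which
accounts for the minus sign. -/
theorem tsum_num_sub (hq0 : q ≠ 0) (hqy : ‖q‖ < ‖y‖) (hy : ‖y‖ < 1)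
    (hqz : ‖q‖ < ‖z‖) (hz : ‖z‖ < 1) :
    ∑' p : ℕ × ℕ, num q y z p.1 p.2
      - ∑' p : ℕ × ℕ, num q y z (-((p.1 : ℤ) + 1)) (-((p.2 : ℤ) + 1)) = kronSum q y z := by
  have hq1 := hqy.trans hy
  have hqn : 0 < ‖q‖ := norm_pos_iff.2 hq0
  have hzn := hqn.trans hqz
  have hz0 : z ≠ 0 := norm_pos_iff.1 hzn
  have hze : ∀ e : ℤ, z * q ^ e ≠ 1 := mul_zpow_ne_one_of_norm hq0 hqz hz
  have hs : Summable fun n : ℤ => y ^ n / (1 - z * q ^ n) :=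
    summable_div_one_sub (e := id) hq0 hq1 (summable_kronWeight hq0 hqy hy) hz0
      fun i hi => absurd hi (hze i)
  have hs1 : Summable fun n : ℕ => y ^ (n : ℤ) / (1 - z * q ^ (n : ℤ)) :=
    hs.comp_injective (i := fun n : ℕ => (n : ℤ)) Nat.cast_injective
  have hs2 : Summable fun n : ℕ => y ^ (-((n : ℤ) + 1)) / (1 - z * q ^ (-((n : ℤ) + 1))) :=
    hs.comp_injective (i := fun n : ℕ => -((n : ℤ) + 1)) fun a b h => by simpa using h
  rw [kronSum, tsum_of_nat_of_neg_add_one (f := fun n : ℤ => y ^ n / (1 - z * q ^ n)) hs1 hs2,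
    (summable_num_nonneg hq1 hy hz).of_norm.tsum_prod,
    (summable_num_neg hq0 hq1 hqy hqz).tsum_prod, sub_eq_add_neg, ← tsum_neg]
  congr 1
  · refine tsum_congr fun s => ?_
    have h1 : ‖z * q ^ s‖ < 1 := by
      rw [norm_mul, norm_pow]
      exact (mul_le_of_le_one_right hzn.le (pow_le_one₀ hqn.le hq1.le)).trans_lt hz
    rw [zpow_natCast, zpow_natCast, div_eq_mul_inv, ← tsum_geometric_of_norm_lt_one h1,
      ← tsum_mul_left]
    refine tsum_congr fun t => ?_
    rw [num, ← Nat.cast_mul, zpow_natCast, zpow_natCast, zpow_natCast, mul_pow, ← pow_mul]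
    ring
  · refine tsum_congr fun m => ?_
    set r := q ^ (m + 1) / z with hr
    have hr1 : ‖r‖ < 1 := by
      rw [hr, norm_div, norm_pow, div_lt_one hzn]
      refine lt_of_le_of_lt ?_ hqz
      exact pow_le_of_le_one hqn.le hq1.le (by simp)
    have hr0 : r ≠ 0 := div_ne_zero (pow_ne_zero _ hq0) hz0
    have h1r : 1 - r ≠ 0 := by
      intro h
      rw [← sub_eq_zero.1 h] at hr1
      simp at hr1
    have e1 : z * q ^ (-((m : ℤ) + 1)) = r⁻¹ := by
      rw [hr, inv_div, zpow_neg, ← Nat.cast_succ, zpow_natCast]; rfl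
    rw [e1]
    have e2 : ∀ n : ℕ, num q y z (-((m : ℤ) + 1)) (-((n : ℤ) + 1))
        = y ^ (-((m : ℤ) + 1)) * r * r ^ n := by
      intro n
      have : q ^ (-((m : ℤ) + 1) * -((n : ℤ) + 1)) = (q ^ (m + 1)) ^ (n + 1) := by
        rw [← pow_mul, ← zpow_natCast, neg_mul_neg]; norm_cast
      rw [num, this, mul_assoc _ r, ← pow_succ', hr, div_pow, zpow_neg z, ← Nat.cast_succ n,
        zpow_natCast z]
      field_simp
    rw [tsum_congr e2, tsum_mul_left, tsum_geometric_of_norm_lt_one hr1]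
    have h2 : r - 1 ≠ 0 := by rw [← neg_sub]; exact neg_ne_zero.2 h1r
    have h3 : 1 - r⁻¹ = (r - 1) / r := by field_simp
    rw [h3]
    field_simp
    ring

theorem tsum_int_eq_nat_add_neg {f : ℤ → ℂ} (hf : Summable f) :
    ∑' n, f n = ∑' n : ℕ, f n + ∑' n : ℕ, f (-(n : ℤ)) - f 0 :=
  (HasSum.of_nat_of_neg (hf.comp_injective Nat.cast_injective).hasSum
    (hf.comp_injective (i := fun n : ℕ => -(n : ℤ)) fun a b h => by simpa using h).hasSum).tsum_eq

/-- The functional equation of the double sum. -/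
theorem doubleSum_mul_sq (hq0 : q ≠ 0) (hqy : ‖q‖ < ‖y‖) (hy : ‖y‖ < 1)
    (hqz : ‖q‖ < ‖z‖) (hz : ‖z‖ < 1) (hx0 : x ≠ 0) (hx : ∀ e : ℤ, x * q ^ e ≠ 1) :
    doubleSum q (q ^ 2 * x) y z = kronSum q y z + q / (y * z) * x *
      (doubleSum q x y z - kronSum q y x - kronSum q z x) := by
  have hq1 := hqy.trans hy
  have hqn : 0 < ‖q‖ := norm_pos_iff.2 hq0
  have hy0 : y ≠ 0 := norm_pos_iff.1 (hqn.trans hqy)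
  have hz0 : z ≠ 0 := norm_pos_iff.1 (hqn.trans hqz)
  have hN := summable_termNonneg hq0 hq1 hy hz hx0 hx
  have hM := summable_term_nonpos hq0 hq1 hqy hqz hx0 hx
  have hNs : Summable fun p : ℕ × ℕ => termNonneg q x y z (p.1 + 1, p.2 + 1) :=
    hN.comp_injective succ_injective_prod
  have e1 : ∑' p, termNonneg q (q ^ 2 * x) y z p = ∑' p : ℕ × ℕ, num q y z p.1 p.2
      + q / (y * z) * x * ∑' p : ℕ × ℕ, termNonneg q x y z (p.1 + 1, p.2 + 1) := by
    rw [← tsum_mul_left, ← (summable_num_nonneg hq1 hy hz).of_norm.tsum_add (hNs.mul_left _)]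
    refine tsum_congr fun p => ?_
    rw [termNonneg, termNonneg, term_mul_sq hq0 hy0 hz0 hx]
    push_cast
    rfl
  have e2 : ∑' p, termNeg q (q ^ 2 * x) y z p
      = ∑' p : ℕ × ℕ, num q y z (-((p.1 : ℤ) + 1)) (-((p.2 : ℤ) + 1))
      + q / (y * z) * x * ∑' p : ℕ × ℕ, term q x y z (-(p.1 : ℤ)) (-(p.2 : ℤ)) := by
    rw [← tsum_mul_left, ← (summable_num_neg hq0 hq1 hqy hqz).tsum_add (hM.mul_left _)]
    refine tsum_congr fun p => ?_
    rw [termNeg, term_mul_sq hq0 hy0 hz0 hx]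
    congr 3 <;> ring
  -- The shift removes the axes from the nonnegative quadrant and adds them to the negative one. The
  -- two halves of each axis join into a full Kronecker series, the corner term being corrected once
  -- for each axis.
  have e3 := tsum_prod_eq_tsum_succ_add hN
  have e4 := tsum_prod_eq_tsum_succ_add hM
  have hsum : ∀ w : ℂ, ‖q‖ < ‖w‖ → ‖w‖ < 1 → Summable fun n : ℤ => w ^ n / (1 - x * q ^ n) :=
    fun w h1 h2 => summable_div_one_sub (e := id) hq0 hq1 (summable_kronWeight hq0 h1 h2) hx0
      fun i hi => absurd hi (hx i)
  have e5 := tsum_int_eq_nat_add_neg (hsum y hqy hy)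
  have e6 := tsum_int_eq_nat_add_neg (hsum z hqz hz)
  have e7 := tsum_num_sub hq0 hqy hy hqz hz
  simp only [termNonneg, term, Nat.cast_zero, neg_zero, mul_zero, zero_mul, zpow_zero, add_zero,
    zero_add, mul_one, one_mul] at e3 e4 e5 e6
  simp only [termNonneg, term] at e1
  simp only [term] at e2
  rw [← e7, doubleSum, doubleSum, kronSum, kronSum]
  simp only [termNonneg, termNeg, term] at e2 ⊢
  simp only [Nat.cast_add, Nat.cast_one] at e1 e2 e3 e4
  rw [e1, e2, e3, e4, e5, e6]
  ring

end DoubleSum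

/-! ### Reflection identities for parameters in the annulus. -/

section Annulus

variable {q y z : ℂ}

theorem norm_sq_lt_norm (hq0 : q ≠ 0) (hq1 : ‖q‖ < 1) : ‖q ^ 2‖ < ‖q‖ := by
  have hqn : 0 < ‖q‖ := norm_pos_iff.2 hq0
  rw [norm_pow]; nlinarith

theorem norm_sq_lt_norm_mul (hqy : ‖q‖ < ‖y‖) (hqz : ‖q‖ < ‖z‖) : ‖q ^ 2‖ < ‖y * z‖ := by
  rw [norm_pow, norm_mul, sq]
  exact mul_lt_mul'' hqy hqz (norm_nonneg _) (norm_nonneg _)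

theorem norm_mul_lt_one (hy : ‖y‖ < 1) (hz : ‖z‖ < 1) : ‖y * z‖ < 1 := by
  rw [norm_mul]
  exact mul_lt_one_of_nonneg_of_lt_one_left (norm_nonneg _) hy hz.le

theorem norm_sq_lt_norm_const_mul (hq0 : q ≠ 0) (hqy : ‖q‖ < ‖y‖) : ‖q ^ 2‖ < ‖q * y‖ := by
  rw [norm_pow, norm_mul, sq]
  exact mul_lt_mul_of_pos_left hqy (norm_pos_iff.2 hq0)

theorem neg_mul_zpow_ne_one (hq0 : q ≠ 0) (hqy : ‖q‖ < ‖y‖) (hy : ‖y‖ < 1) :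
    ∀ k : ℤ, -y * (q ^ 2) ^ k ≠ 1 :=
  mul_zpow_ne_one_of_norm (pow_ne_zero 2 hq0)
    (by rw [norm_neg]; exact (norm_sq_lt_norm hq0 (hqy.trans hy)).trans hqy) (by rwa [norm_neg])

theorem theta_sq_ne_zero (hq0 : q ≠ 0) (hqy : ‖q‖ < ‖y‖) (hy : ‖y‖ < 1) :
    theta y (q ^ 2) ≠ 0 :=
  theta_ne_zero_of_norm (norm_sq_lt_one (hqy.trans hy))
    ((norm_sq_lt_norm hq0 (hqy.trans hy)).trans hqy) hy

theorem theta_const_mul_ne_zero (hq0 : q ≠ 0) (hqy : ‖q‖ < ‖y‖) (hy : ‖y‖ < 1) :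
    theta (q * y) (q ^ 2) ≠ 0 :=
  theta_ne_zero_of_norm (norm_sq_lt_one (hqy.trans hy)) (norm_sq_lt_norm_const_mul hq0 hqy)
    (norm_mul_lt_one (hqy.trans hy) hy)

theorem theta_neg_ne_zero (hq0 : q ≠ 0) (hqy : ‖q‖ < ‖y‖) (hy : ‖y‖ < 1) :
    theta (-y) (q ^ 2) ≠ 0 :=
  theta_sq_ne_zero hq0 (by rwa [norm_neg]) (by rwa [norm_neg])

/-- The reflection `(z, y)` of a normalised Lerch-type sum in terms of `(y, z)`. -/
theorem lerchSum_div_add_lerchSum_div (hq0 : q ≠ 0) (hqy : ‖q‖ < ‖y‖) (hy : ‖y‖ < 1)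
    (hqz : ‖q‖ < ‖z‖) (hz : ‖z‖ < 1) :
    lerchSum q y z / thetaSum q y + lerchSum q z y / thetaSum q z = 1
      + qPoch (q ^ 2) (q ^ 2) * theta (-q) (q ^ 2) * theta (y * z) (q ^ 2)
        / (theta (q * y) (q ^ 2) * theta (q * z) (q ^ 2) * theta (-y) (q ^ 2)
          * theta (-z) (q ^ 2)) := by
  have hq1 := hqy.trans hy
  have hqn : 0 < ‖q‖ := norm_pos_iff.2 hq0
  have hy0 : y ≠ 0 := norm_pos_iff.1 (hqn.trans hqy)
  have hz0 : z ≠ 0 := norm_pos_iff.1 (hqn.trans hqz)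
  have hp0 : q ^ 2 ≠ 0 := pow_ne_zero 2 hq0
  have hp1 : ‖q ^ 2‖ < 1 := norm_sq_lt_one hq1
  have hθz := theta_const_mul_ne_zero hq0 hqz hz
  have hΘz : thetaSum q z ≠ 0 := by
    rw [thetaSum_eq hq0 hq1 hz0]; exact mul_ne_zero (qPoch_self_ne_zero hp1) hθz
  have hyz := mul_zpow_ne_one_of_norm hp0 (norm_sq_lt_norm_mul hqy hqz) (norm_mul_lt_one hy hz)
  have e1 : z⁻¹ / y = (y * z)⁻¹ := by field_simp
  have e2 : z⁻¹ / y * z = y⁻¹ := by field_simp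
  -- With this choice `w / u * v = y⁻¹`, and `lerchSum_add_inv` turns the sum at `(z⁻¹, y⁻¹)` into
  -- the one at `(z, y)`, leaving the constant `1`.
  have h := lerchSum_div_sub hq0 hq1 (u := y) (w := z⁻¹) (v := z) hy0 (inv_ne_zero hz0) hz0
    (theta_const_mul_ne_zero hq0 hqy hy)
    (by
      rw [← theta_div _ hp0, show q ^ 2 / (q * z⁻¹) = q * z by field_simp]
      exact hθz)
    (fun k hk => hyz (-k) (by
      rw [e1] at hk
      rw [zpow_neg, ← inv_eq_one, mul_inv, inv_inv, hk]))
    (neg_mul_zpow_ne_one hq0 hqz hz)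
    (by rw [e2]; exact neg_inv_mul_zpow_ne_one (neg_mul_zpow_ne_one hq0 hqy hy))
  have e3 := lerchSum_add_inv hq0 hq1 hz0 hy0 (neg_mul_zpow_ne_one hq0 hqy hy)
  have e4 : -(z⁻¹ / q) * z = (-q)⁻¹ := by field_simp
  have e5 : -(z⁻¹ / y) * z = (-y)⁻¹ := by field_simp
  have e6 : z⁻¹ / q = (q * z)⁻¹ := by field_simp
  rw [e2, e4, e5, e6, e1, thetaSum_inv hq0 hq1 hz0, eq_sub_of_add_eq' e3,
    theta_inv hp0 hp1 (mul_ne_zero hy0 hz0), theta_inv hp0 hp1 (mul_ne_zero hq0 hz0),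
    theta_inv hp0 hp1 (neg_ne_zero.2 hq0), theta_inv hp0 hp1 (neg_ne_zero.2 hy0),
    sub_div, div_self hΘz, neg_one_mul] at h
  have h1 : lerchSum q y z / thetaSum q y + lerchSum q z y / thetaSum q z - 1
      = lerchSum q y z / thetaSum q y - (1 - lerchSum q z y / thetaSum q z) := by ring
  rw [← sub_eq_iff_eq_add', h1, h]
  have n1 := theta_const_mul_ne_zero hq0 hqy hy
  have n2 := theta_neg_ne_zero hq0 hqy hy
  have n3 := theta_neg_ne_zero hq0 hqz hz
  field_simp

/-- The companion reflection, needed for the pole at `x = q`: change of base with `u = q y`, `w = (q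
z)⁻¹`. Now `w / u * v = (q² y)⁻¹`, and the extra shift by `q²` cancels the theta series, so no
constant appears. -/
theorem lerchSum_const_mul_add (hq0 : q ≠ 0) (hqy : ‖q‖ < ‖y‖) (hy : ‖y‖ < 1)
    (hqz : ‖q‖ < ‖z‖) (hz : ‖z‖ < 1) :
    lerchSum q (q * y) z / theta y (q ^ 2) + lerchSum q (q * z) y / theta z (q ^ 2) =
      qPoch (q ^ 2) (q ^ 2) ^ 2 * theta (-1) (q ^ 2) * theta (y * z) (q ^ 2)
        / (theta y (q ^ 2) * theta z (q ^ 2) * theta (-y) (q ^ 2) * theta (-z) (q ^ 2)) := by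
  have hq1 := hqy.trans hy
  have hqn : 0 < ‖q‖ := norm_pos_iff.2 hq0
  have hy0 : y ≠ 0 := norm_pos_iff.1 (hqn.trans hqy)
  have hz0 : z ≠ 0 := norm_pos_iff.1 (hqn.trans hqz)
  have hqz0 : q * z ≠ 0 := mul_ne_zero hq0 hz0
  have hp0 : q ^ 2 ≠ 0 := pow_ne_zero 2 hq0
  have hp1 : ‖q ^ 2‖ < 1 := norm_sq_lt_one hq1
  have hP := qPoch_self_ne_zero hp1
  have n1 := theta_sq_ne_zero hq0 hqy hy
  have n2 := theta_sq_ne_zero hq0 hqz hz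
  have n3 := theta_neg_ne_zero hq0 hqy hy
  have n4 := theta_neg_ne_zero hq0 hqz hz
  have hyz := mul_zpow_ne_one_of_norm hp0 (norm_sq_lt_norm_mul hqy hqz) (norm_mul_lt_one hy hz)
  have hmul : ∀ a : ℂ, a ≠ 0 → theta (q * (q * a)) (q ^ 2) = -a⁻¹ * theta a (q ^ 2) := by
    intro a ha
    rw [← theta_mul hp0 hp1 ha]; congr 1; ring
  have hinv : ∀ a : ℂ, a ≠ 0 → theta (q ^ 2 * a)⁻¹ (q ^ 2)
      = (q ^ 2 * a)⁻¹ * a⁻¹ * theta a (q ^ 2) := by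
    intro a ha
    rw [theta_inv hp0 hp1 (mul_ne_zero hp0 ha), theta_mul hp0 hp1 ha]; ring
  have hΘ : ∀ a : ℂ, a ≠ 0 → thetaSum q (q * a)
      = -(qPoch (q ^ 2) (q ^ 2) * a⁻¹ * theta a (q ^ 2)) := by
    intro a ha
    rw [thetaSum_eq hq0 hq1 (mul_ne_zero hq0 ha), hmul a ha]; ring
  have e1 : (q * z)⁻¹ / (q * y) = (q ^ 2 * (y * z))⁻¹ := by field_simp
  have e2 : (q * z)⁻¹ / (q * y) * z = (q ^ 2 * y)⁻¹ := by field_simp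
  have e4 : -((q * z)⁻¹ / q) * z = (q ^ 2 * -1)⁻¹ := by field_simp
  have e5 : -((q * z)⁻¹ / (q * y)) * z = (q ^ 2 * -y)⁻¹ := by field_simp
  have e6 : (q * z)⁻¹ / q = (q ^ 2 * z)⁻¹ := by field_simp
  have hqqy : ∀ k : ℤ, -(q ^ 2 * y)⁻¹ * (q ^ 2) ^ k ≠ 1 := by
    refine neg_inv_mul_zpow_ne_one ?_
    have := mul_mul_zpow_ne_one hp0 (neg_mul_zpow_ne_one hq0 hqy hy)
    simpa using this
  have h := lerchSum_div_sub hq0 hq1 (u := q * y) (w := (q * z)⁻¹) (v := z)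
    (mul_ne_zero hq0 hy0) (inv_ne_zero hqz0) hz0
    (by rw [hmul y hy0]; exact mul_ne_zero (neg_ne_zero.2 (inv_ne_zero hy0)) n1)
    (by
      rw [← theta_div _ hp0, show q ^ 2 / (q * (q * z)⁻¹) = q ^ 2 * z by field_simp,
        theta_mul hp0 hp1 hz0]
      exact mul_ne_zero (neg_ne_zero.2 (inv_ne_zero hz0)) n2)
    (fun k hk => mul_mul_zpow_ne_one hp0 hyz (-k) (by
      rw [e1] at hk
      rw [zpow_neg, ← inv_eq_one, mul_inv, inv_inv, hk]))
    (neg_mul_zpow_ne_one hq0 hqz hz)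
    (by rw [e2]; exact hqqy)
  have e3 := lerchSum_add_inv hq0 hq1 hqz0 hy0 (neg_mul_zpow_ne_one hq0 hqy hy)
  have e7 := lerchSum_mul_right hq0 hq1 (inv_ne_zero hqz0)
    (inv_ne_zero (mul_ne_zero hp0 hy0)) hqqy
  rw [show q ^ 2 * (q ^ 2 * y)⁻¹ = y⁻¹ by field_simp,
    show q / (q * z)⁻¹ * (q ^ 2 * y)⁻¹ = z / y by field_simp, thetaSum_inv hq0 hq1 hqz0] at e7
  have e8 : lerchSum q (q * z)⁻¹ (q ^ 2 * y)⁻¹ = -(y / z) * lerchSum q (q * z) y := by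
    rw [e7] at e3
    have e9 : z / y * lerchSum q (q * z)⁻¹ (q ^ 2 * y)⁻¹ = -lerchSum q (q * z) y := by
      linear_combination e3
    field_simp at e9 ⊢
    linear_combination e9
  rw [e2, e4, e5, e6, e1, thetaSum_inv hq0 hq1 hqz0, e8, hΘ y hy0, hΘ z hz0, hmul y hy0,
    hinv _ (mul_ne_zero hy0 hz0), hinv z hz0, hinv (-1) (by norm_num), hinv (-y) (neg_ne_zero.2 hy0),
    neg_one_mul] at h
  have h1 : lerchSum q (q * y) z / theta y (q ^ 2) + lerchSum q (q * z) y / theta z (q ^ 2)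
      = -(qPoch (q ^ 2) (q ^ 2) / y) *
        (lerchSum q (q * y) z / -(qPoch (q ^ 2) (q ^ 2) * y⁻¹ * theta y (q ^ 2))
        - -(y / z) * lerchSum q (q * z) y / -(qPoch (q ^ 2) (q ^ 2) * z⁻¹ * theta z (q ^ 2))) := by
    field_simp
    ring
  rw [h1, h]
  field_simp

end Annulus

/-! ### The closed form: functional equation, poles, comparison. -/

section ClosedForm

variable {q : ℂ}

/-- The coefficient of the Lerch-type sum in `lerchPart`. -/
def lerchCoeff (q a b : ℂ) : ℂ :=
  qPoch q q ^ 2 / qPoch (q ^ 2) (q ^ 2) / theta b q * theta (b * a) (q ^ 2) * (theta a q)⁻¹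

theorem lerchPart_eq (q a b c : ℂ) :
    lerchPart q a b c = lerchCoeff q a b * lerchSum q (b * a) c := by
  simp only [lerchPart, lerchCoeff, lerchSum, qPochs, theta, List.map_cons, List.map_nil,
    List.prod_cons, List.prod_nil, mul_one, mul_comm b a, div_eq_mul_inv, mul_inv]
  ring

theorem lerchCoeff_comm (q a b : ℂ) : lerchCoeff q a b = lerchCoeff q b a := by
  rw [lerchCoeff, lerchCoeff, mul_comm b a]
  simp only [div_eq_mul_inv]
  ring

/-- The triple product supplies the missing half of `theta (b * a) q` in its splitting to base `q²`.
The result is the right-hand side of Kronecker's formula. -/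
theorem lerchCoeff_mul_thetaSum (hq0 : q ≠ 0) (hq1 : ‖q‖ < 1) {a b : ℂ} (ha : a ≠ 0)
    (hb : b ≠ 0) :
    lerchCoeff q a b * thetaSum q (b * a)
      = qPoch q q ^ 2 * theta (b * a) q / (theta a q * theta b q) := by
  have hP := qPoch_self_ne_zero (norm_sq_lt_one hq1)
  rw [lerchCoeff, thetaSum_eq hq0 hq1 (mul_ne_zero hb ha), theta_sq (b * a) hq1 hq0,
    div_eq_mul_inv _ (theta a q * theta b q), mul_inv]
  field_simp

theorem theta_mul_sq (hq0 : q ≠ 0) (hq1 : ‖q‖ < 1) {x : ℂ} (hx : x ≠ 0) :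
    theta (q ^ 2 * x) q = (q * x ^ 2)⁻¹ * theta x q := by
  rw [sq, mul_assoc, theta_mul hq0 hq1 (mul_ne_zero hq0 hx), theta_mul hq0 hq1 hx]
  field_simp

theorem lerchCoeff_mul_sq (hq0 : q ≠ 0) (hq1 : ‖q‖ < 1) {a b : ℂ} (ha : a ≠ 0) (hb : b ≠ 0) :
    lerchCoeff q (q ^ 2 * a) b = -(q / b * a) * lerchCoeff q a b := by
  have hp0 : q ^ 2 ≠ 0 := pow_ne_zero 2 hq0
  have hp1 : ‖q ^ 2‖ < 1 := norm_sq_lt_one hq1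
  rw [lerchCoeff, lerchCoeff, theta_mul_sq hq0 hq1 ha, mul_left_comm b, theta_mul hp0 hp1
    (mul_ne_zero hb ha), mul_inv _ (theta a q)]
  field_simp

theorem analyticAt_inv_theta {p : ℂ} (hp1 : ‖p‖ < 1) {c a : ℂ} (hc : c ≠ 0) (ha : a ≠ 0)
    (h : theta (c * a) p ≠ 0) : AnalyticAt ℂ (fun x => (theta (c * x) p)⁻¹) a :=
  (analyticAt_theta_const_mul hp1 hc ha).inv h

/-- Transport of the pole at `1` by `theta_mul`; the sign comes from the factor `-x⁻¹`. -/
theorem poleAt_inv_theta_self (hq0 : q ≠ 0) (hq1 : ‖q‖ < 1) :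
    PoleAt (fun x => (theta x q)⁻¹) q (-(qPoch q q ^ 2)⁻¹) := by
  have h1 := (poleAt_inv_theta_const_mul hq1 (inv_ne_zero hq0) (inv_mul_cancel₀ hq0)).analytic_mul
    (u := fun x => -(x / q)) hq0 (by fun_prop)
  have hne : ∀ᶠ x in 𝓝[≠] q, x ≠ 0 := (isOpen_ne.eventually_mem hq0).filter_mono nhdsWithin_le_nhds
  refine (h1.congr ?_).congr_residue (by rw [div_self hq0]; ring)
  filter_upwards [hne] with x hx
  have h2 := theta_mul hq0 hq1 (mul_ne_zero (inv_ne_zero hq0) hx)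
  rw [mul_inv_cancel_left₀ hq0] at h2
  rw [h2, mul_inv]
  congr 1
  field_simp

/-- The quotient of theta products in `thetaPart` without the factors singular in `x`. -/
def thetaCoeff (q y z x : ℂ) : ℂ :=
  qPoch (q ^ 2) (q ^ 2) ^ 3 * theta (y * z) (q ^ 2)
    / (theta y q * theta z q * theta (-y) (q ^ 2) * theta (-z) (q ^ 2))
    * (theta (y * x) (q ^ 2) * theta (z * x) (q ^ 2))

theorem thetaPart_eq (q x y z : ℂ) :
    thetaPart q x y z = thetaCoeff q y z x * ((theta x q)⁻¹ * (theta (-1 * x) (q ^ 2))⁻¹) := by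
  have h : ∀ w : ℂ, -q ^ 2 / w = q ^ 2 / -w := fun w => by rw [div_neg, neg_div]
  simp only [thetaPart, thetaCoeff, qPochs, theta, List.map_cons, List.map_nil,
    List.prod_cons, List.prod_nil, mul_one, mul_comm y x, mul_comm z x, div_eq_mul_inv, mul_inv,
    neg_one_mul]
  simp only [← div_eq_mul_inv, h]
  simp only [div_eq_mul_inv]
  ring

theorem thetaPart_mul_sq (hq0 : q ≠ 0) (hq1 : ‖q‖ < 1) {x y z : ℂ} (hx : x ≠ 0) (hy : y ≠ 0)
    (hz : z ≠ 0) :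
    thetaPart q (q ^ 2 * x) y z = q / (y * z) * x * thetaPart q x y z := by
  have hp0 : q ^ 2 ≠ 0 := pow_ne_zero 2 hq0
  have hp1 : ‖q ^ 2‖ < 1 := norm_sq_lt_one hq1
  have h10 : (-1 : ℂ) ≠ 0 := by norm_num
  rw [thetaPart_eq, thetaPart_eq, thetaCoeff, thetaCoeff, theta_mul_sq hq0 hq1 hx,
    mul_left_comm y, mul_left_comm z, mul_left_comm (-1), theta_mul hp0 hp1 (mul_ne_zero hy hx),
    theta_mul hp0 hp1 (mul_ne_zero hz hx), theta_mul hp0 hp1 (mul_ne_zero h10 hx),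
    mul_inv _ (theta x q), mul_inv _ (theta (-1 * x) (q ^ 2))]
  field_simp

theorem closedForm_eq (q x y z : ℂ) :
    closedForm q x y z = lerchCoeff q z y * lerchSum q (y * z) x
      + lerchCoeff q x y * lerchSum q (y * x) z - 2 * thetaPart q x y z
      + lerchCoeff q x z * lerchSum q (z * x) y := by
  rw [closedForm, lerchPart_eq, lerchPart_eq, lerchPart_eq, mul_comm z y, lerchCoeff_comm q y z]

variable {y z : ℂ}

theorem doubleSum_eq_closedForm (hq0 : q ≠ 0) (hqy : ‖q‖ < ‖y‖) (hy : ‖y‖ < 1)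
    (hqz : ‖q‖ < ‖z‖) (hz : ‖z‖ < 1) {x : ℂ} (hx0 : x ≠ 0) (hx : ∀ e : ℤ, x * q ^ e ≠ 1)
    (hx' : ∀ k : ℤ, -x * (q ^ 2) ^ k ≠ 1) : doubleSum q x y z = closedForm q x y z := by
  have hq1 := hqy.trans hy
  have hqn : 0 < ‖q‖ := norm_pos_iff.2 hq0
  have hy0 : y ≠ 0 := norm_pos_iff.1 (hqn.trans hqy)
  have hz0 : z ≠ 0 := norm_pos_iff.1 (hqn.trans hqz)
  have hp0 : q ^ 2 ≠ 0 := pow_ne_zero 2 hq0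
  have hp1 : ‖q ^ 2‖ < 1 := norm_sq_lt_one hq1
  have h10 : (-1 : ℂ) ≠ 0 := by norm_num
  have hP := qPoch_self_ne_zero hp1
  have hQ := qPoch_self_ne_zero hq1
  have hθy : theta y q ≠ 0 := theta_ne_zero_of_norm hq1 hqy hy
  have hθz : theta z q ≠ 0 := theta_ne_zero_of_norm hq1 hqz hz
  have hy' := neg_mul_zpow_ne_one hq0 hqy hy
  have hz' := neg_mul_zpow_ne_one hq0 hqz hz
  have n1 := theta_sq_ne_zero hq0 hqy hy
  have n2 := theta_sq_ne_zero hq0 hqz hz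
  have n3 := theta_neg_ne_zero hq0 hqy hy
  have n4 := theta_neg_ne_zero hq0 hqz hz
  have n5 := theta_const_mul_ne_zero hq0 hqy hy
  have n6 := theta_const_mul_ne_zero hq0 hqz hz
  have hθy2 := theta_sq y hq1 hq0
  have hθz2 := theta_sq z hq1 hq0
  have hneg1 : ∀ e : ℤ, -1 * q ^ e ≠ 1 := by
    intro e he
    have h1 : q ^ e = -1 := by linear_combination -he
    rcases eq_or_ne e 0 with rfl | h0
    · norm_num at h1
    · have h2 := congrArg norm h1
      rw [norm_zpow, norm_neg, norm_one, zpow_eq_one_iff_right₀ hqn.le hq1.ne] at h2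
      exact h0 h2
  have hsq : ∀ k : ℤ, (q ^ 2) ^ k = q ^ (2 * k) := fun k => by
    rw [zpow_mul]; norm_cast
  have hneg1' : ∀ k : ℤ, -1 * (q ^ 2) ^ k ≠ 1 := fun k => by rw [hsq]; exact hneg1 _
  have hnegq' : ∀ k : ℤ, -q * (q ^ 2) ^ k ≠ 1 := fun k => by
    have := hneg1 (2 * k + 1)
    rwa [zpow_add_one₀ hq0, ← hsq, mul_comm ((q ^ 2) ^ k), ← mul_assoc, neg_one_mul] at this
  have hθ1 : theta (-1) q = theta (-1) (q ^ 2) * theta (-q) (q ^ 2) := by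
    rw [theta_sq _ hq1 hq0, mul_neg_one]
  have hθ1' := theta_neg_one_mul hq1
  have m1 : theta (-1) (q ^ 2) ≠ 0 := theta_ne_zero_of_mul_zpow hp0 hp1 h10 hneg1'
  have m2 : theta (-q) (q ^ 2) ≠ 0 :=
    theta_ne_zero_of_mul_zpow hp0 hp1 (neg_ne_zero.2 hq0) hnegq'
  have m3 : theta (-1) q ≠ 0 := theta_ne_zero_of_mul_zpow hq0 hq1 h10 hneg1
  -- The two Lerch-type parts with `x` in the first argument, stripped of `(theta x q)⁻¹`, are
  -- analytic off `0`; every pole they produce comes from that common factor.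
  set U : ℂ → ℂ → ℂ → ℂ := fun b c x => qPoch q q ^ 2 / qPoch (q ^ 2) (q ^ 2) / theta b q
    * theta (b * x) (q ^ 2) * lerchSum q (b * x) c with hU
  have hUan : ∀ b c : ℂ, b ≠ 0 → c ≠ 0 → (∀ k : ℤ, -c * (q ^ 2) ^ k ≠ 1) → ∀ a, a ≠ 0 →
      AnalyticAt ℂ (U b c) a := by
    intro b c hb hc0 hc a ha
    refine (analyticAt_const.mul (analyticAt_theta_const_mul hp1 hb ha)).mul ?_
    exact AnalyticAt.comp (g := fun u => lerchSum q u c) (f := fun x => b * x)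
      (analyticAt_lerchSum_left hq0 hq1 (mul_ne_zero hb ha) hc0 hc) (by fun_prop)
  have hVan : ∀ a, a ≠ 0 → AnalyticAt ℂ (thetaCoeff q y z) a := fun a ha =>
    analyticAt_const.mul ((analyticAt_theta_const_mul hp1 hy0 ha).mul
      (analyticAt_theta_const_mul hp1 hz0 ha))
  set W : ℂ → ℂ := fun x => U y z x + U z y x with hW
  have hWan : ∀ a, a ≠ 0 → AnalyticAt ℂ W a := fun a ha =>
    (hUan y z hy0 hz0 hz' a ha).add (hUan z y hz0 hy0 hy' a ha)
  set g : ℂ → ℂ := fun x => doubleSum q x y z - closedForm q x y z with hg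
  have hgeq : g = fun x => doubleSum q x y z - lerchCoeff q z y * lerchSum q (y * z) x
      - W x * (theta x q)⁻¹
      + 2 * (thetaCoeff q y z x * ((theta x q)⁻¹ * (theta (-1 * x) (q ^ 2))⁻¹)) := by
    funext x
    simp only [hg, closedForm_eq, thetaPart_eq, hW, hU, lerchCoeff]
    ring
  have hreg : ∀ a, a ≠ 0 → (∀ e : ℤ, a * q ^ e ≠ 1) → (∀ k : ℤ, -a * (q ^ 2) ^ k ≠ 1) →
      AnalyticAt ℂ g a := by
    intro a ha h1 h2
    have hi := (analyticAt_theta hq1 ha).inv (theta_ne_zero_of_mul_zpow hq0 hq1 ha h1)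
    have hi' := analyticAt_inv_theta hp1 h10 ha
      (theta_ne_zero_of_mul_zpow hp0 hp1 (mul_ne_zero h10 ha) (by simpa using h2))
    rw [hgeq]
    exact (((analyticAt_doubleSum hq0 hqy hy hqz hz ha fun e _ => h1 e).sub
      (analyticAt_const.mul (analyticAt_lerchSum_right hq0 hq1 _ ha h2))).sub
      ((hWan a ha).mul hi)).add (analyticAt_const.mul ((hVan a ha).mul (hi.mul hi')))
  have hfe : ∀ a, a ≠ 0 → ∀ᶠ x in 𝓝[≠] a, g (q ^ 2 * x) = q / (y * z) * x * g x := by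
    intro a ha
    have hne : ∀ᶠ x in 𝓝[≠] a, x ≠ 0 := (isOpen_ne.eventually_mem ha).filter_mono nhdsWithin_le_nhds
    have hev : ∀ᶠ x in 𝓝[≠] a, ∀ k : ℤ, -1 * x * (q ^ 2) ^ k ≠ 1 :=
      (tendsto_const_mul_punctured h10).eventually
        (eventually_mul_zpow_ne_one hp0 hp1 (mul_ne_zero h10 ha))
    filter_upwards [hne, eventually_mul_zpow_ne_one hq0 hq1 ha, hev] with x hx0 hx1 hx2
    have k1 : kronSum q y z = lerchCoeff q z y * thetaSum q (y * z) := by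
      rw [kronSum_eq hq0 hqy hy hz0 (mul_zpow_ne_one_of_norm hq0 hqz hz),
        lerchCoeff_mul_thetaSum hq0 hq1 hz0 hy0]
    have k2 : kronSum q y x = lerchCoeff q x y * thetaSum q (y * x) := by
      rw [kronSum_eq hq0 hqy hy hx0 hx1, lerchCoeff_mul_thetaSum hq0 hq1 hx0 hy0]
    have k3 : kronSum q z x = lerchCoeff q x z * thetaSum q (z * x) := by
      rw [kronSum_eq hq0 hqz hz hx0 hx1, lerchCoeff_mul_thetaSum hq0 hq1 hx0 hz0]
    simp only [hg, closedForm_eq]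
    rw [doubleSum_mul_sq hq0 hqy hy hqz hz hx0 hx1, k1, k2, k3,
      thetaPart_mul_sq hq0 hq1 hx0 hy0 hz0, lerchCoeff_mul_sq hq0 hq1 hx0 hy0,
      lerchCoeff_mul_sq hq0 hq1 hx0 hz0, mul_left_comm y (q ^ 2), mul_left_comm z (q ^ 2),
      lerchSum_mul_left hq0 hq1 hz0 hz', lerchSum_mul_left hq0 hq1 hy0 hy',
      lerchSum_mul_right hq0 hq1 (mul_ne_zero hy0 hz0) hx0 (by simpa using hx2)]
    field_simp
    ring
  -- The term `s = t = 0` contributes `1`. The reflection identity supplies a matching `1` and a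
  -- theta quotient that cancels `thetaPart`.
  have hpole1 : PoleAt g 1 0 := by
    have p1 := poleAt_doubleSum hq0 hqy hy hqz hz
    have p2 := (poleAt_of_analyticAt (analyticAt_lerchSum_right hq0 hq1 (y * z) one_ne_zero
      hneg1')).const_mul one_ne_zero (lerchCoeff q z y)
    have p3 := (poleAt_inv_theta hq1).analytic_mul one_ne_zero (hWan 1 one_ne_zero)
    have p4 := ((poleAt_inv_theta hq1).analytic_mul one_ne_zero ((hVan 1 one_ne_zero).mul
      (analyticAt_inv_theta hp1 h10 one_ne_zero (by rwa [mul_one])))).const_mul one_ne_zero 2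
    rw [hgeq]
    refine ((((p1.sub one_ne_zero p2).sub one_ne_zero p3).add p4).congr ?_).congr_residue ?_
    · refine Eventually.of_forall fun x => ?_
      simp only [Pi.mul_apply]; ring
    · have hI := lerchSum_div_add_lerchSum_div hq0 hqy hy hqz hz
      rw [thetaSum_eq hq0 hq1 hy0, thetaSum_eq hq0 hq1 hz0] at hI
      rw [hθ1] at hθ1'
      simp only [Pi.mul_apply, hW, hU, thetaCoeff, mul_one, hθy2, hθz2]
      have e1 : (qPoch q q ^ 2 / qPoch (q ^ 2) (q ^ 2) / (theta y (q ^ 2) * theta (q * y) (q ^ 2))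
            * theta y (q ^ 2) * lerchSum q y z
          + qPoch q q ^ 2 / qPoch (q ^ 2) (q ^ 2) / (theta z (q ^ 2) * theta (q * z) (q ^ 2))
            * theta z (q ^ 2) * lerchSum q z y) * (qPoch q q ^ 2)⁻¹
          = lerchSum q y z / (qPoch (q ^ 2) (q ^ 2) * theta (q * y) (q ^ 2))
          + lerchSum q z y / (qPoch (q ^ 2) (q ^ 2) * theta (q * z) (q ^ 2)) := by
        field_simp
      rw [e1, hI]
      field_simp
      linear_combination -(qPoch (q ^ 2) (q ^ 2) * theta (y * z) (q ^ 2)) * hθ1'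
  -- The double sum is regular here, consistently with the absence of a constant in
  -- `lerchSum_const_mul_add`.
  have hpoleq : PoleAt g q 0 := by
    have p1 := poleAt_of_analyticAt (analyticAt_doubleSum hq0 hqy hy hqz hz hq0 fun e he => by
      rw [← zpow_one_add₀ hq0]
      exact zpow_ne_one hq1 (by omega))
    have p2 := (poleAt_of_analyticAt (analyticAt_lerchSum_right hq0 hq1 (y * z) hq0
      hnegq')).const_mul hq0 (lerchCoeff q z y)
    have p3 := (poleAt_inv_theta_self hq0 hq1).analytic_mul hq0 (hWan q hq0)
    have p4 := ((poleAt_inv_theta_self hq0 hq1).analytic_mul hq0 ((hVan q hq0).mul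
      (analyticAt_inv_theta hp1 h10 hq0 (by rwa [neg_one_mul])))).const_mul hq0 2
    rw [hgeq]
    refine ((((p1.sub hq0 p2).sub hq0 p3).add p4).congr ?_).congr_residue ?_
    · refine Eventually.of_forall fun x => ?_
      simp only [Pi.mul_apply]; ring
    · have hI := lerchSum_const_mul_add hq0 hqy hy hqz hz
      rw [hθ1] at hθ1'
      simp only [Pi.mul_apply, hW, hU, thetaCoeff, mul_comm y q, mul_comm z q, hθy2, hθz2,
        neg_one_mul]
      have e1 : (qPoch q q ^ 2 / qPoch (q ^ 2) (q ^ 2) / (theta y (q ^ 2) * theta (q * y) (q ^ 2))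
            * theta (q * y) (q ^ 2) * lerchSum q (q * y) z
          + qPoch q q ^ 2 / qPoch (q ^ 2) (q ^ 2) / (theta z (q ^ 2) * theta (q * z) (q ^ 2))
            * theta (q * z) (q ^ 2) * lerchSum q (q * z) y) * -(qPoch q q ^ 2)⁻¹
          = -(qPoch (q ^ 2) (q ^ 2))⁻¹ * (lerchSum q (q * y) z / theta y (q ^ 2)
          + lerchSum q (q * z) y / theta z (q ^ 2)) := by
        field_simp
      rw [e1, hI]
      field_simp
      linear_combination (qPoch (q ^ 2) (q ^ 2) * theta (y * z) (q ^ 2)) * hθ1'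
  -- Only the Lerch-type sum in `x` and the theta quotient are singular here.
  have hpolen : PoleAt g (-1) 0 := by
    have p1 := poleAt_of_analyticAt (analyticAt_doubleSum hq0 hqy hy hqz hz h10 fun e _ => hneg1 e)
    have p2 := (poleAt_lerchSum hq0 hq1 (y * z)).const_mul h10 (lerchCoeff q z y)
    have hi := (analyticAt_theta hq1 h10).inv m3
    have p3 := poleAt_of_analyticAt ((hWan (-1) h10).mul hi)
    have p4 := ((poleAt_inv_theta_const_mul hp1 h10
      (show (-1 : ℂ) * -1 = 1 by ring)).analytic_mul h10 ((hVan (-1) h10).mul hi)).const_mul h10 2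
    rw [hgeq]
    refine ((((p1.sub h10 p2).sub h10 p3).add p4).congr ?_).congr_residue ?_
    · refine Eventually.of_forall fun x => ?_
      simp only [Pi.mul_apply, Pi.inv_apply]; ring
    · simp only [Pi.mul_apply, Pi.inv_apply, thetaCoeff, lerchCoeff, mul_neg_one, mul_one]
      field_simp
      linear_combination -theta (y * z) (q ^ 2) * hθ1'
  have hφ0 : ∀ x : ℂ, x ≠ 0 → q / (y * z) * x ≠ 0 := fun x hx =>
    mul_ne_zero (div_ne_zero hq0 (mul_ne_zero hy0 hz0)) hx
  have hpole : ∀ a, a ≠ 0 → PoleAt g a 0 := by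
    intro a ha
    have htr : ∀ b, b ≠ 0 → PoleAt g b 0 → ∀ n : ℤ, PoleAt g ((q ^ 2) ^ n * b) 0 :=
      fun b hb hgb n => PoleAt.zpow_mul hp0 (φ := fun x => q / (y * z) * x) (fun _ => by fun_prop)
        hφ0 hfe hb hgb n
    by_cases h1 : ∀ e : ℤ, a * q ^ e ≠ 1
    · by_cases h2 : ∀ k : ℤ, -a * (q ^ 2) ^ k ≠ 1
      · exact poleAt_of_analyticAt (hreg a ha h1 h2)
      · rw [mul_zpow_ne_one_iff hp0] at h2
        push Not at h2
        obtain ⟨n, hn⟩ := h2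
        refine (htr _ h10 hpolen n).congr_point ?_
        rw [← hn]; ring
    · rw [mul_zpow_ne_one_iff hq0] at h1
      push Not at h1
      obtain ⟨n, rfl⟩ := h1
      -- Multiplication by `q²` splits the powers of `q` into two orbits, those of `1` and `q`.
      obtain ⟨m, rfl | rfl⟩ := n.even_or_odd'
      · refine (htr _ one_ne_zero hpole1 m).congr_point ?_
        rw [hsq, mul_one]
      · refine (htr _ hq0 hpoleq m).congr_point ?_
        rw [hsq, zpow_add_one₀ hq0]
  have hzero := eq_zero_of_quasiperiodic hp0 hp1 hpole (φ := fun x => q / (y * z) * x)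
    (by fun_prop) hφ0 (by simp) (fun n h => pow_ne_zero n hp0 (by simpa using h.symm)) hfe hx0
    (hreg x hx0 hx hx').continuousAt
  exact sub_eq_zero.1 hzero

end ClosedForm

end Kronecker

end

/-! ### The theorem. -/

open Kronecker in
theorem theorem1 (q x y z : ℂ) (hq0 : q ≠ 0) (hq1 : ‖q‖ < 1)
    (hqy : ‖q‖ < ‖y‖) (hy : ‖y‖ < 1) (hqz : ‖q‖ < ‖z‖) (hz : ‖z‖ < 1)
    (hx0 : x ≠ 0) (hx : ∀ n : ℤ, x ≠ q ^ n) :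
    -- both halves of the double sum converge absolutely
    Summable (Kronecker.termNonneg q x y z) ∧
    Summable (Kronecker.termNeg q x y z) ∧
    -- the identity, wherever no denominator on the right-hand side vanishes
    ((∀ k : ℤ, x ≠ -q ^ (2 * k)) →
      Summable (Kronecker.lerchTerm q (y * z) x) ∧
      Summable (Kronecker.lerchTerm q (x * y) z) ∧
      Summable (Kronecker.lerchTerm q (x * z) y) ∧
      Kronecker.doubleSum q x y z = Kronecker.closedForm q x y z) ∧
    -- at the remaining points the right-hand side has a removable singularity in `x`,
    -- and the identity holds with its limit there
    ((∃ k : ℤ, x = -q ^ (2 * k)) →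
      Tendsto (fun w : ℂ => Kronecker.closedForm q w y z) (𝓝[≠] x)
        (𝓝 (Kronecker.doubleSum q x y z))) := by
  have hqn : 0 < ‖q‖ := norm_pos_iff.2 hq0
  have hy0 : y ≠ 0 := norm_pos_iff.1 (hqn.trans hqy)
  have hz0 : z ≠ 0 := norm_pos_iff.1 (hqn.trans hqz)
  have hp0 : q ^ 2 ≠ 0 := pow_ne_zero 2 hq0
  have hx1 : ∀ e : ℤ, x * q ^ e ≠ 1 := (mul_zpow_ne_one_iff hq0).2 hx
  refine ⟨summable_termNonneg hq0 hq1 hy hz hx0 hx1, summable_termNeg hq0 hq1 hqy hqz hx0 hx1,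
    fun h => ?_, fun _ => ?_⟩
  · have hx2 : ∀ k : ℤ, -x * (q ^ 2) ^ k ≠ 1 := by
      rw [mul_zpow_ne_one_iff hp0]
      intro k hk
      apply h k
      rw [zpow_mul, ← neg_eq_iff_eq_neg, hk]
      norm_cast
    exact ⟨summable_lerchTerm hq0 hq1 _ hx0 hx2,
      summable_lerchTerm hq0 hq1 _ hz0 (neg_mul_zpow_ne_one hq0 hqz hz),
      summable_lerchTerm hq0 hq1 _ hy0 (neg_mul_zpow_ne_one hq0 hqy hy),
      doubleSum_eq_closedForm hq0 hqy hy hqz hz hx0 hx1 hx2⟩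
  -- The double sum is analytic at `x`, which is not a power of `q`, and equals the closed form on a
  -- punctured neighbourhood.
  · have hcont : Tendsto (fun w => doubleSum q w y z) (𝓝[≠] x) (𝓝 (doubleSum q x y z)) :=
      (analyticAt_doubleSum hq0 hqy hy hqz hz hx0 fun e _ => hx1 e).continuousAt.tendsto.mono_left
        nhdsWithin_le_nhds
    refine hcont.congr' ?_
    have h10 : (-1 : ℂ) ≠ 0 := by norm_num
    have hev : ∀ᶠ w in 𝓝[≠] x, ∀ k : ℤ, -1 * w * (q ^ 2) ^ k ≠ 1 :=
      (tendsto_const_mul_punctured h10).eventually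
        (eventually_mul_zpow_ne_one hp0 (norm_sq_lt_one hq1) (mul_ne_zero h10 hx0))
    have hne : ∀ᶠ w in 𝓝[≠] x, w ≠ 0 :=
      (isOpen_ne.eventually_mem hx0).filter_mono nhdsWithin_le_nhds
    filter_upwards [eventually_mul_zpow_ne_one hq0 hq1 hx0, hev, hne] with w h1 h2 h3
    exact doubleSum_eq_closedForm hq0 hqy hy hqz hz h3 h1 (by simpa using h2)
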